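/- A single item is sold to $n$ agents in a sealed-bid first-price auction: every agent submits a bid $b_i\ge 0$, a highest bidder wins (ties are broken by an arbitrary fixed, possibly randomized, rule that depends on the bid profile), the winner pays their bid, and the others pay nothing. The values $v_1,\dots,v_n\ge 0$ of the agents are independent, the law of $v_i$ having a density (the laws need not be identical). A profile of bidding strategies $\mathbf b(\cdot)=(b_1(\cdot),\dots,b_n(\cdot))$, mapping values to bids, is a Bayes-Nash equilibrium if for every agent $i$ and (almost) every value $v_i$ the bid $b_i(v_i)$ maximizes, over all bids $b\ge 0$, the expected utility $\mathbf E_{\mathbf v_{-i}}\big[(v_i-b)\,\tilde x_i(b,\mathbf b_{-i}(\mathbf v_{-i}))\big]$, where $\tilde x_i(\mathbf b)$ is the probability that $i$ wins under the bid profile $\mathbf b$. Theorem. For every Bayes-Nash equilibrium $\mathbf b(\cdot)$ of such an auction, the expected value of the winner satisfies $$\mathbf E\Big[\sum_i v_i\,\tilde x_i(\mathbf b(\mathbf v))\Big]\ \ge\ 0.743\cdot \mathbf E\big[\max_i v_i\big].$$ More precisely, the inequality holds with $0.743$ replaced by the constant $$c=\min_{x\in[0,1)}\frac{\int_x^1 \ell(t)\,dt}{1-x},\qquad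 \ell(q)=\min_{r\in[0,1]}\Big[1-r(1-q)\ln\Big(1+\frac{1-r}{(1-q)r}\Big)\Big]$$ (the bracket being $1$ for $r=0$ or $q=1$), and $0.743\le c<0.744$. -/

import Mathlib

open MeasureTheory

/-- A single-item first-price auction with `n` agents. A bid profile `b` gives the item to agent `i`
with probability `alloc b i`; only a highest bidder can win. Ties are broken by an arbitrary, possibly
randomized, measurable rule (a deterministic rule is one with values in `{0, 1}`). -/
structure FirstPriceAuction (n : ℕ) where
  alloc : (Fin n → ℝ) → Fin n → ℝ
  measurable_alloc : ∀ i, Measurable fun b => alloc b i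
  alloc_nonneg : ∀ b i, 0 ≤ alloc b i
  sum_alloc : ∀ b, ∑ i, alloc b i = 1
  highest_of_alloc_pos : ∀ b i, 0 < alloc b i → ∀ j, b j ≤ b i

namespace FirstPriceAuction

variable {n : ℕ}

/-- The (expected) payment of agent `i`: the winner pays their bid, the others pay nothing. -/
def payment (A : FirstPriceAuction n) (b : Fin n → ℝ) (i : Fin n) : ℝ :=
  b i * A.alloc b i

/-- The utility of agent `i` with value `vi` under the bid profile `b`. -/
def utility (A : FirstPriceAuction n) (i : Fin n) (vi : ℝ) (b : Fin n → ℝ) : ℝ :=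
  vi * A.alloc b i - A.payment b i

/-- The interim expected utility of agent `i` with value `vi` who bids `x`, when every other agent `j`
bids `β j (v j)` and the values `v j` are independent with laws `μ j`. The `i`-th entry of the bid
profile is overwritten by `x`, so the `i`-th coordinate of `v` plays no role. -/
noncomputable def interimUtility (A : FirstPriceAuction n) (μ : Fin n → Measure ℝ)
    (β : Fin n → ℝ → ℝ) (i : Fin n) (vi x : ℝ) : ℝ :=
  ∫ v, A.utility i vi (Function.update (fun j => β j (v j)) i x) ∂(Measure.pi μ)

/-- The strategy profile `β` is a Bayes-Nash equilibrium: strategies are measurable, and for each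
agent `i` and almost every value of `i`, the bid is a best response among all non-negative bids. -/
def IsBayesNash (A : FirstPriceAuction n) (μ : Fin n → Measure ℝ) (β : Fin n → ℝ → ℝ) : Prop :=
  (∀ i, Measurable (β i)) ∧
  ∀ i, ∀ᵐ vi ∂(μ i), 0 ≤ β i vi ∧
    ∀ x, 0 ≤ x → A.interimUtility μ β i vi x ≤ A.interimUtility μ β i vi (β i vi)

/-- The expected welfare of the strategy profile `β`: the expected value of the winner. -/
noncomputable def welfare (A : FirstPriceAuction n) (μ : Fin n → Measure ℝ)
    (β : Fin n → ℝ → ℝ) : ENNReal :=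
  ∫⁻ v, ∑ i, ENNReal.ofReal (v i * A.alloc (fun j => β j (v j)) i) ∂(Measure.pi μ)

end FirstPriceAuction

/-- The optimal welfare: the expectation of the highest value. -/
noncomputable def optimalWelfare {n : ℕ} (μ : Fin n → Measure ℝ) : ENNReal :=
  ∫⁻ v, ⨆ i, ENNReal.ofReal (v i) ∂(Measure.pi μ)

/-- `1 - r (1 - q) ln (1 + (1 - r) / ((1 - q) r))`. For `r = 0` or `q = 1` this evaluates to `1`, which
is the continuous extension. -/
noncomputable def welfareFraction (q r : ℝ) : ℝ :=
  1 - r * (1 - q) * Real.log (1 + (1 - r) / ((1 - q) * r))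

/-! The core is a conditional estimate. Let agent i have the strictly highest value v, let b be the
bid of i at v, and let q be the probability that all values are at most v. Then, given these facts,
the winner has expected value at least v ℓ(q). Suppose a rival j with value t < v wins with a bid z
> b. Write F_i for the distribution function of the highest rival bid (`rivalCdf`). Optimality for i
gives (v - z) F_i(z) ≤ (v - b) F_i(b), and optimality for j gives (t - b) F_j(b) ≤ (t - z) F_j(z).
The products F_i and F_j differ in one factor only, and i bids at most b with probability at least
q, so F_j(b)/F_j(z) ≥ q F_i(b)/F_i(z). Subtracting eliminates z: F_i(z)(v - t) ≤ F_i(b)(v - q t)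
(`rivalCdf_mul_sub_le`). By `bidCdf_mul_le`, F_i may be replaced by the distribution function G of
the top bid given that all rival values are below v. With x = G(b), the fraction of v that is lost
is at most (1 - q) x / (G(z) - q x). This decreases in G(z), and above b the variable G(z) dominates
a uniform one on (x, 1], so the expected loss is at most ∫_x^1 (1 - q) x / (s - q x) ds = 1 -
`welfareFraction q x`. If i has no positive utility, nothing is lost: the rivals almost surely push
the price up to v. Averaging over v and i bounds the welfare below by E[V ℓ(F(V))], where V is the
highest value and F its distribution function. Since ℓ is increasing, Chebyshev's inequality
separates the factors, and F(V) dominates a uniform variable, leaving E[V] ∫_0^1 ℓ. Monotonicity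
also puts the minimum defining c at x = 0. For the numerics, ℓ itself is awkward, but its level sets
are explicit: 1 - ℓ(q) > w iff q < 1 - `lossLevel w`. Hence ∫ ℓ = 1 - 1/e + ∫_0^{1/e} `lossLevel`.
Tangent bounds for `lossLevel` justify midpoint sums from below and trapezoid sums from above. -/

/-! ### The function ℓ: attained minima and monotonicity. -/

theorem welfareFraction_eq {q r : ℝ} (hq : q ∈ Set.Icc (0 : ℝ) 1) (hr : r ∈ Set.Icc (0 : ℝ) 1) :
    welfareFraction q r =
      1 - r * (1 - q) * Real.log (1 - q * r) - Real.negMulLog ((1 - q) * r) := by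
  unfold welfareFraction Real.negMulLog
  rcases hr.1.eq_or_lt with h | hr0
  · simp [← h]
  rcases hq.2.eq_or_lt with h | hq1
  · simp [h]
  have hs : 0 < 1 - q := by linarith
  have hqr : 0 < 1 - q * r := by nlinarith [hr.2, hq.1]
  have : 1 + (1 - r) / ((1 - q) * r) = (1 - q * r) / ((1 - q) * r) := by
    field_simp
    ring
  rw [this, Real.log_div hqr.ne' (by positivity)]
  ring

theorem continuousOn_welfareFraction {q : ℝ} (hq : q ∈ Set.Icc (0 : ℝ) 1) :
    ContinuousOn (welfareFraction q) (Set.Icc 0 1) := by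
  rcases hq.2.eq_or_lt with h | hq1
  · have : welfareFraction q = fun _ => 1 := by
      funext r
      simp [welfareFraction, h]
    rw [this]
    exact continuousOn_const
  -- In this form the only singular term at `r = 0` is `negMulLog`, which is continuous there.
  refine ContinuousOn.congr (f := fun r =>
    1 - r * (1 - q) * Real.log (1 - q * r) - Real.negMulLog ((1 - q) * r)) ?_
    fun r hr => welfareFraction_eq hq hr
  refine ContinuousOn.sub ?_ (by fun_prop)
  refine continuousOn_const.sub (ContinuousOn.mul (by fun_prop) ?_)
  refine ContinuousOn.log (by fun_prop) fun r hr => ?_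
  nlinarith [hr.1, hr.2, hq.1]

theorem welfareFraction_zero_right (q : ℝ) : welfareFraction q 0 = 1 := by
  simp [welfareFraction]

/-- The least value of `welfareFraction q` on the unit interval. -/
noncomputable def leastFraction (q : ℝ) : ℝ := sInf (welfareFraction q '' Set.Icc 0 1)

theorem isLeast_leastFraction {q : ℝ} (hq : q ∈ Set.Icc (0 : ℝ) 1) :
    IsLeast (welfareFraction q '' Set.Icc (0 : ℝ) 1) (leastFraction q) :=
  (isCompact_Icc.image_of_continuousOn (continuousOn_welfareFraction hq)).isLeast_sInf
    ((Set.nonempty_Icc.2 zero_le_one).image _)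

theorem leastFraction_le {q r : ℝ} (hq : q ∈ Set.Icc (0 : ℝ) 1) (hr : r ∈ Set.Icc (0 : ℝ) 1) :
    leastFraction q ≤ welfareFraction q r :=
  (isLeast_leastFraction hq).2 ⟨r, hr, rfl⟩

theorem leastFraction_le_one {q : ℝ} (hq : q ∈ Set.Icc (0 : ℝ) 1) : leastFraction q ≤ 1 :=
  (leastFraction_le hq ⟨le_rfl, zero_le_one⟩).trans_eq (welfareFraction_zero_right q)

theorem le_leastFraction {q a : ℝ} (hq : q ∈ Set.Icc (0 : ℝ) 1)
    (h : ∀ r ∈ Set.Icc (0 : ℝ) 1, a ≤ welfareFraction q r) : a ≤ leastFraction q := by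
  obtain ⟨r, hr, h'⟩ := (isLeast_leastFraction hq).1
  exact h' ▸ h r hr

/-- `s ↦ s log (1 + a / s)` is nondecreasing. -/
theorem mul_log_one_add_div_mono {a s t : ℝ} (ha : 0 ≤ a) (hs : 0 ≤ s) (hst : s ≤ t) :
    s * Real.log (1 + a / s) ≤ t * Real.log (1 + a / t) := by
  rcases hs.eq_or_lt with rfl | hs
  · simpa using mul_nonneg hst (Real.log_nonneg (by linarith [div_nonneg ha hst]))
  have ht : 0 < t := hs.trans_le hst
  have h := strictConcaveOn_log_Ioi.concaveOn.2 (show 1 + a / s ∈ Set.Ioi 0 by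
    simp only [Set.mem_Ioi]; positivity) (show (1 : ℝ) ∈ Set.Ioi 0 by simp)
    (show 0 ≤ s / t by positivity) (show 0 ≤ 1 - s / t from sub_nonneg.2 ((div_le_one ht).2 hst))
    (by ring)
  have e : s / t * (1 + a / s) + (1 - s / t) * 1 = 1 + a / t := by
    field_simp
    ring
  simp only [smul_eq_mul, Real.log_one, mul_zero, add_zero, e] at h
  calc s * Real.log (1 + a / s) = t * (s / t * Real.log (1 + a / s)) := by field_simp
    _ ≤ _ := by gcongr

theorem welfareFraction_mono {q q' r : ℝ} (hq' : q' ≤ 1) (hqq' : q ≤ q')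
    (hr : r ∈ Set.Icc (0 : ℝ) 1) : welfareFraction q r ≤ welfareFraction q' r := by
  have h := mul_log_one_add_div_mono (a := (1 - r) / r) (s := 1 - q') (t := 1 - q)
    (div_nonneg (by linarith [hr.2]) hr.1) (by linarith) (by linarith)
  simp only [div_div, mul_comm r] at h
  have := mul_le_mul_of_nonneg_left h hr.1
  simp only [welfareFraction]
  linarith

theorem leastFraction_monotoneOn : MonotoneOn leastFraction (Set.Icc 0 1) := by
  intro q hq q' hq' h
  exact le_leastFraction hq' fun r hr =>
    (leastFraction_le hq hr).trans (welfareFraction_mono hq'.2 h hr)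

/-! ### Level sets of ℓ and the integral of ℓ. -/

/-- The bound `log (y * w) ≤ y * w - 1` linearizes the logarithm. The loss is then at most a convex
combination, with weights `r` and `1 - r`, of `(1 - q) * (w - 1 - log w)` and `w`. -/
theorem one_sub_le_welfareFraction {q r w : ℝ} (hq : q ∈ Set.Icc (0 : ℝ) 1)
    (hr : r ∈ Set.Icc (0 : ℝ) 1) (hw : 0 < w) (h : (1 - q) * (w - 1 - Real.log w) ≤ w) :
    1 - w ≤ welfareFraction q r := by
  rcases hr.1.eq_or_lt with h0 | hr0
  · simp only [welfareFraction, ← h0]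
    simp [hw.le]
  rcases hq.2.eq_or_lt with h1 | hq1
  · simp only [welfareFraction, h1]
    simp [hw.le]
  have hs : 0 < 1 - q := by linarith
  set y := 1 + (1 - r) / ((1 - q) * r) with hy
  have hy0 : 0 < y := by
    have : 0 ≤ (1 - r) / ((1 - q) * r) := div_nonneg (by linarith [hr.2]) (by positivity)
    linarith
  have hlog := Real.log_le_sub_one_of_pos (mul_pos hy0 hw)
  rw [Real.log_mul hy0.ne' hw.ne'] at hlog
  have e : r * (1 - q) * y = r * (1 - q) + (1 - r) := by
    rw [hy]
    field_simp
  have h2 : r * (1 - q) * Real.log y ≤ r * (1 - q) * (y * w - 1 - Real.log w) :=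
    mul_le_mul_of_nonneg_left (by linarith) (by positivity)
  have h3 : r * (1 - q) * (y * w - 1 - Real.log w) =
      r * ((1 - q) * (w - 1 - Real.log w)) + (1 - r) * w := by
    linear_combination w * e
  have h4 := mul_le_mul_of_nonneg_left h hr.1
  unfold welfareFraction
  linarith

theorem exists_welfareFraction_lt {q w : ℝ} (hq : q ∈ Set.Icc (0 : ℝ) 1) (hw : 0 < w)
    (hw1 : w < 1) (h : w < (1 - q) * (w - 1 - Real.log w)) :
    ∃ r ∈ Set.Icc (0 : ℝ) 1, welfareFraction q r < 1 - w := by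
  rcases hq.2.eq_or_lt with h1 | hq1
  · simp only [h1] at h
    linarith
  have hs : 0 < 1 - q := by linarith
  have hd : 0 < (1 - q) * (1 - w) + w := by nlinarith
  -- This `r` makes the argument of the logarithm equal to `w⁻¹`, the equality case of the
  -- linearization in `one_sub_le_welfareFraction`.
  refine ⟨w / ((1 - q) * (1 - w) + w), ⟨by positivity, ?_⟩, ?_⟩
  · rw [div_le_one hd]
    nlinarith
  · have e : 1 + (1 - w / ((1 - q) * (1 - w) + w)) / ((1 - q) * (w / ((1 - q) * (1 - w) + w)))
        = w⁻¹ := by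
      field_simp
      ring
    rw [welfareFraction, e, Real.log_inv]
    have : w < w / ((1 - q) * (1 - w) + w) * (1 - q) * -Real.log w := by
      rw [div_mul_eq_mul_div, div_mul_eq_mul_div, lt_div_iff₀ hd, mul_assoc]
      exact mul_lt_mul_of_pos_left (by linarith) hw
    linarith

/-- The inverse of `s ↦ 1 - leastFraction (1 - s)`, in the range `0 < w ≤ 1 / e`. -/
noncomputable def lossLevel (w : ℝ) : ℝ := w / (w - 1 - Real.log w)

theorem lossLevel_denom_pos {w : ℝ} (hw : 0 < w) (hw1 : w < 1) : 0 < w - 1 - Real.log w := by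
  linarith [Real.log_lt_sub_one_of_pos hw hw1.ne]

theorem lossLevel_pos {w : ℝ} (hw : 0 < w) (hw1 : w < 1) : 0 < lossLevel w :=
  div_pos hw (lossLevel_denom_pos hw hw1)

theorem lt_one_sub_leastFraction_iff {q w : ℝ} (hq : q ∈ Set.Icc (0 : ℝ) 1) (hw : 0 < w)
    (hw1 : w < 1) : w < 1 - leastFraction q ↔ q < 1 - lossLevel w := by
  have hD := lossLevel_denom_pos hw hw1
  constructor
  · contrapose!
    intro h
    have h' : 1 - q ≤ lossLevel w := by linarith
    rw [lossLevel, le_div_iff₀ hD] at h'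
    linarith [le_leastFraction hq fun r hr => one_sub_le_welfareFraction hq hr hw h']
  · intro h
    have h' : lossLevel w < 1 - q := by linarith
    rw [lossLevel, div_lt_iff₀ hD] at h'
    obtain ⟨r, hr, hlt⟩ := exists_welfareFraction_lt hq hw hw1 h'
    linarith [leastFraction_le hq hr]

theorem lossLevel_monotoneOn : MonotoneOn lossLevel (Set.Icc 0 (Real.exp (-1))) := by
  intro w hw w' hw' h
  have he : Real.exp (-1) < 1 := by simp
  rcases hw.1.eq_or_lt with h0 | hw0
  · rcases hw'.1.eq_or_lt with h0' | hw0'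
    · rw [← h0, ← h0']
    · rw [← h0]
      simpa [lossLevel] using (lossLevel_pos hw0' (hw'.2.trans_lt he)).le
  have hw0' := hw0.trans_le h
  have hl := (Real.log_le_iff_le_exp hw0').2 hw'.2
  have hl' := Real.log_le_log hw0 h
  rw [lossLevel, lossLevel, div_le_div_iff₀ (lossLevel_denom_pos hw0 (hw.2.trans_lt he))
    (lossLevel_denom_pos hw0' (hw'.2.trans_lt he))]
  nlinarith

theorem lossLevel_exp_neg_one : lossLevel (Real.exp (-1)) = 1 := by
  have := Real.exp_pos (-1)
  rw [lossLevel, Real.log_exp]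
  field_simp
  ring

theorem intervalIntegrable_lossLevel {a b : ℝ} (ha : a ∈ Set.Icc 0 (Real.exp (-1)))
    (hb : b ∈ Set.Icc 0 (Real.exp (-1))) : IntervalIntegrable lossLevel volume a b :=
  (lossLevel_monotoneOn.mono ((Set.uIcc_subset_Icc ha hb))).intervalIntegrable

theorem intervalIntegrable_leastFraction {a b : ℝ} (ha : a ∈ Set.Icc (0 : ℝ) 1)
    (hb : b ∈ Set.Icc (0 : ℝ) 1) : IntervalIntegrable leastFraction volume a b :=
  (leastFraction_monotoneOn.mono ((Set.uIcc_subset_Icc ha hb))).intervalIntegrable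

/-- Layer-cake formula for `1 - leastFraction`: its superlevel sets are intervals with right
endpoint `1 - lossLevel w`. -/
theorem integral_leastFraction :
    ∫ q in (0 : ℝ)..1, leastFraction q = 1 - ∫ w in (0 : ℝ)..Real.exp (-1), (1 - lossLevel w) := by
  have he : Real.exp (-1) < 1 := by simp
  have he0 := Real.exp_pos (-1)
  have hi := intervalIntegrable_leastFraction (a := 0) (b := 1) (by simp) (by simp)
  have h1 : ∫ q in (0 : ℝ)..1, (1 - leastFraction q) = 1 - ∫ q in (0 : ℝ)..1, leastFraction q := by
    rw [intervalIntegral.integral_sub (by simp) hi]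
    simp
  have hint : Integrable (fun q => 1 - leastFraction q) (volume.restrict (Set.Ioc 0 1)) :=
    (intervalIntegrable_iff_integrableOn_Ioc_of_le zero_le_one).1
      ((intervalIntegrable_const (c := (1 : ℝ))).sub hi)
  have h2 := hint.integral_eq_integral_meas_lt (by
    filter_upwards [ae_restrict_mem measurableSet_Ioc] with q hq
    simpa using leastFraction_le_one (Set.Ioc_subset_Icc_self hq))
  rw [← intervalIntegral.integral_of_le zero_le_one, h1] at h2
  suffices h : ∫ t in Set.Ioi (0 : ℝ), (volume.restrict (Set.Ioc (0 : ℝ) 1)).real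
      {q | t < 1 - leastFraction q} = ∫ w in (0 : ℝ)..Real.exp (-1), (1 - lossLevel w) by
    linarith
  rw [intervalIntegral.integral_of_le he0.le]
  have hval : ∀ w ∈ Set.Ioc 0 (Real.exp (-1)), (volume.restrict (Set.Ioc (0 : ℝ) 1)).real
      {q | w < 1 - leastFraction q} = 1 - lossLevel w := by
    intro w hw
    have hlv : lossLevel w ≤ 1 :=
      (lossLevel_monotoneOn ⟨hw.1.le, hw.2⟩ ⟨he0.le, le_rfl⟩ hw.2).trans_eq lossLevel_exp_neg_one
    have hp := lossLevel_pos hw.1 (hw.2.trans_lt he)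
    have hset : {q | w < 1 - leastFraction q} ∩ Set.Ioc (0 : ℝ) 1 = Set.Ioo 0 (1 - lossLevel w) := by
      ext q
      constructor
      · rintro ⟨h, hq⟩
        exact ⟨hq.1, (lt_one_sub_leastFraction_iff (Set.Ioc_subset_Icc_self hq) hw.1
          (hw.2.trans_lt he)).1 h⟩
      · intro hq
        have hq1 : q ∈ Set.Ioc (0 : ℝ) 1 := ⟨hq.1, by linarith [hq.2]⟩
        exact ⟨(lt_one_sub_leastFraction_iff (Set.Ioc_subset_Icc_self hq1) hw.1
          (hw.2.trans_lt he)).2 hq.2, hq1⟩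
    rw [measureReal_def, Measure.restrict_apply' measurableSet_Ioc, hset, Real.volume_Ioo,
      ENNReal.toReal_ofReal (by linarith), sub_zero]
  rw [← setIntegral_congr_fun measurableSet_Ioc hval]
  refine setIntegral_eq_of_subset_of_forall_sdiff_eq_zero measurableSet_Ioi
    Set.Ioc_subset_Ioi_self fun w hw => ?_
  have hw0 : 0 < w := hw.1
  have hwe : Real.exp (-1) ≤ w := by
    by_contra! h
    exact hw.2 ⟨hw0, h.le⟩
  -- Levels from 1/e on are never exceeded, because `lossLevel` already reaches 1 at 1/e.
  have hset : {q | w < 1 - leastFraction q} ∩ Set.Ioc (0 : ℝ) 1 = ∅ := by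
    refine Set.eq_empty_of_forall_notMem ?_
    rintro q ⟨h, hq⟩
    have := (lt_one_sub_leastFraction_iff (Set.Ioc_subset_Icc_self hq) he0 he).1
      (hwe.trans_lt h)
    rw [lossLevel_exp_neg_one] at this
    linarith [hq.1]
  rw [measureReal_def, Measure.restrict_apply' measurableSet_Ioc, hset]
  simp

/-- The average of a nondecreasing function over [x, 1] is least at x = 0. -/
theorem isLeast_integral_leastFraction :
    IsLeast ((fun x => (∫ t in x..1, leastFraction t) / (1 - x)) '' Set.Ico (0 : ℝ) 1)
      (∫ t in (0 : ℝ)..1, leastFraction t) := by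
  refine ⟨⟨0, by simp, by simp⟩, ?_⟩
  rintro _ ⟨x, hx, rfl⟩
  have hxI : x ∈ Set.Icc (0 : ℝ) 1 := ⟨hx.1, hx.2.le⟩
  have h0I : (0 : ℝ) ∈ Set.Icc (0 : ℝ) 1 := by simp
  have h1I : (1 : ℝ) ∈ Set.Icc (0 : ℝ) 1 := by simp
  have hs := intervalIntegral.integral_add_adjacent_intervals
    (intervalIntegrable_leastFraction h0I hxI) (intervalIntegrable_leastFraction hxI h1I)
  have ha : ∫ t in (0 : ℝ)..x, leastFraction t ≤ x * leastFraction x := by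
    have := intervalIntegral.integral_mono_on (g := fun _ => leastFraction x) hx.1
      (intervalIntegrable_leastFraction h0I hxI) (by simp) fun t ht =>
        leastFraction_monotoneOn ⟨ht.1, ht.2.trans hx.2.le⟩ hxI ht.2
    simpa using this
  have hb : (1 - x) * leastFraction x ≤ ∫ t in x..1, leastFraction t := by
    have := intervalIntegral.integral_mono_on (f := fun _ => leastFraction x) hx.2.le
      (by simp) (intervalIntegrable_leastFraction hxI h1I) fun t ht =>
        leastFraction_monotoneOn hxI ⟨hx.1.trans ht.1, ht.2⟩ ht.1
    simpa using this
  simp only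
  rw [← hs, le_div_iff₀ (by linarith [hx.2])]
  nlinarith [mul_le_mul_of_nonneg_left hb hx.1, mul_le_mul_of_nonneg_left ha (sub_nonneg.2 hx.2.le)]

/-! ### Numerical enclosure of the constant. -/

theorem neg_log_mul_self_le {m : ℝ} (hm : 0 < m) : -Real.log m * m ≤ Real.exp (-1) := by
  have he := Real.exp_pos (-1)
  have h := Real.log_le_sub_one_of_pos (div_pos he hm)
  rw [Real.log_div he.ne' hm.ne', Real.log_exp] at h
  have h' := mul_le_mul_of_nonneg_right h hm.le
  have : (Real.exp (-1) / m - 1) * m = Real.exp (-1) - m := by field_simp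
  linarith

/-- A quantitative substitute for convexity that avoids second derivatives. Bounding `log (w / m)`
below by `1 - m / w` makes the inequality rational in `w`. The last hypothesis, with -m log m ≤ 1/e
< 0.368, fixes the sign of the remaining factor. -/
theorem lossLevel_tangent_le {m w : ℝ} (hm : 0 < m) (hm1 : m < 1) (hw : 0 < w) (hw1 : w < 1)
    (h : 0.368 * w ≤ m * (1 - m)) :
    lossLevel m + -Real.log m / (m - 1 - Real.log m) ^ 2 * (w - m) ≤ lossLevel w := by
  have hDm := lossLevel_denom_pos hm hm1
  have hDw := lossLevel_denom_pos hw hw1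
  have hlog := Real.one_sub_inv_le_log_of_pos (div_pos hw hm)
  rw [Real.log_div hw.ne' hm.ne', inv_div] at hlog
  have hw' : -Real.log m * w ≤ 1 - m := by
    have h1 := mul_le_mul_of_nonneg_right (neg_log_mul_self_le hm) hw.le
    have h2 : Real.exp (-1) * w ≤ 0.368 * w := by
      have := Real.exp_neg_one_lt_d9
      gcongr
      linarith
    refine le_of_mul_le_mul_right ?_ hm
    linarith
  rw [lossLevel, lossLevel]
  set L := -Real.log m with hL
  have hLp : 0 < L := by linarith [Real.log_neg hm hm1]
  have hm' : m - 1 - Real.log m = m - 1 + L := by rw [hL]; ring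
  rw [hm'] at hDm ⊢
  have e : m / (m - 1 + L) + L / (m - 1 + L) ^ 2 * (w - m) =
      (L * w - m * (1 - m)) / (m - 1 + L) ^ 2 := by
    field_simp
    ring
  rw [e, div_le_div_iff₀ (by positivity) hDw]
  by_cases hneg : L * w - m * (1 - m) ≤ 0
  · exact (mul_nonpos_of_nonpos_of_nonneg hneg hDw.le).trans (by positivity)
  have hD : w - 1 - Real.log w ≤ w - 2 + L + m / w := by linarith
  refine (mul_le_mul_of_nonneg_left hD (not_le.1 hneg).le).trans ?_
  rw [← sub_nonneg]
  -- The difference has a double zero at the point of tangency; the other factor is nonnegative by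
  -- `hw'`.
  have : w * (m - 1 + L) ^ 2 - (L * w - m * (1 - m)) * (w - 2 + L + m / w) =
      (w - m) ^ 2 * ((1 - m) - L * w) / w := by
    field_simp
    ring
  rw [this]
  exact div_nonneg (mul_nonneg (sq_nonneg _) (by linarith)) hw.le

theorem midpoint_le_integral_lossLevel {a b m : ℝ} (ha : 0 ≤ a) (hab : a < b)
    (hb : b ≤ Real.exp (-1)) (hm : a + b = 2 * m) (h : 0.368 * b ≤ m * (1 - m)) :
    (b - a) * lossLevel m ≤ ∫ w in a..b, lossLevel w := by
  have he : Real.exp (-1) < 1 := by simp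
  have hint : ∫ w in a..b, (lossLevel m + -Real.log m / (m - 1 - Real.log m) ^ 2 * (w - m)) =
      (b - a) * lossLevel m := by
    rw [intervalIntegral.integral_add (by simp)
        ((by fun_prop : Continuous _).intervalIntegrable _ _),
      intervalIntegral.integral_const_mul, intervalIntegral.integral_sub (by simp) (by simp)]
    simp only [intervalIntegral.integral_const, integral_id, smul_eq_mul]
    have : (b ^ 2 - a ^ 2) / 2 - (b - a) * m = 0 := by linear_combination (b - a) * hm / 2
    rw [this]
    ring
  rw [← hint]
  refine intervalIntegral.integral_mono_on_of_le_Ioo hab.le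
    ((by fun_prop : Continuous _).intervalIntegrable _ _)
    (intervalIntegrable_lossLevel ⟨ha, hab.le.trans hb⟩ ⟨ha.trans hab.le, hb⟩) fun w hw => ?_
  refine lossLevel_tangent_le (by linarith) (by linarith) (by linarith [hw.1]) (by linarith [hw.2])
    (le_trans ?_ h)
  linarith [hw.2]

theorem integral_lossLevel_le_trapezoid {a b : ℝ} (ha : 0 < a) (hab : a < b)
    (hb : b ≤ Real.exp (-1)) (h : 0.368 * b ≤ a * (1 - a)) :
    ∫ w in a..b, lossLevel w ≤ (b - a) * ((lossLevel a + lossLevel b) / 2) := by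
  have he := Real.exp_neg_one_lt_d9
  have hba : 0 < b - a := by linarith
  have hint : ∫ w in a..b, (lossLevel a + (lossLevel b - lossLevel a) / (b - a) * (w - a)) =
      (b - a) * ((lossLevel a + lossLevel b) / 2) := by
    rw [intervalIntegral.integral_add (by simp)
        ((by fun_prop : Continuous _).intervalIntegrable _ _),
      intervalIntegral.integral_const_mul, intervalIntegral.integral_sub (by simp) (by simp)]
    simp only [intervalIntegral.integral_const, integral_id, smul_eq_mul]
    field_simp
    ring
  rw [← hint]
  refine intervalIntegral.integral_mono_on hab.le
    (intervalIntegrable_lossLevel ⟨ha.le, hab.le.trans hb⟩ ⟨ha.le.trans hab.le, hb⟩)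
    ((by fun_prop : Continuous _).intervalIntegrable _ _) fun w hw => ?_
  have hw0 : 0 < w := by linarith [hw.1]
  have hw1 : w ≤ 1 / 2 := by linarith [hw.2]
  have hcond : 0.368 * b ≤ w * (1 - w) := by nlinarith [hw.1]
  have h1 := lossLevel_tangent_le hw0 (by linarith) ha (by linarith) (by linarith)
  have h2 := lossLevel_tangent_le hw0 (by linarith) (ha.trans hab) (by linarith) hcond
  set s := -Real.log w / (w - 1 - Real.log w) ^ 2
  -- The height of the chord above the graph is a weighted mean of the gaps at `a` and `b` above the
  -- tangent at `w`.
  have key : lossLevel a + (lossLevel b - lossLevel a) / (b - a) * (w - a) - lossLevel w =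
      ((b - w) * (lossLevel a - lossLevel w - s * (a - w)) +
        (w - a) * (lossLevel b - lossLevel w - s * (b - w))) / (b - a) := by
    field_simp
    ring
  rw [← sub_nonneg, key]
  refine div_nonneg (add_nonneg (mul_nonneg ?_ ?_) (mul_nonneg ?_ ?_)) hba.le <;>
    linarith [hw.1, hw.2]

/-- The tangent bound is unavailable near 0. Instead, `lossLevel w / w` is the reciprocal of a
decreasing function, so the graph lies below its chord from the origin. -/
theorem integral_zero_lossLevel_le {b : ℝ} (hb0 : 0 < b) (hb : b ≤ Real.exp (-1)) :
    ∫ w in (0 : ℝ)..b, lossLevel w ≤ b * lossLevel b / 2 := by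
  have he : Real.exp (-1) < 1 := by simp
  have hint : ∫ w in (0 : ℝ)..b, w * (lossLevel b / b) = b * lossLevel b / 2 := by
    rw [intervalIntegral.integral_mul_const, integral_id]
    field_simp
    ring
  rw [← hint]
  refine intervalIntegral.integral_mono_on_of_le_Ioo hb0.le
    (intervalIntegrable_lossLevel ⟨le_rfl, hb0.le.trans hb⟩ ⟨hb0.le, hb⟩)
    ((by fun_prop : Continuous _).intervalIntegrable _ _) fun w hw => ?_
  have hDw := lossLevel_denom_pos hw.1 (by linarith [hw.2])
  have hDb := lossLevel_denom_pos hb0 (by linarith)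
  have hmono : b - 1 - Real.log b ≤ w - 1 - Real.log w := by
    have h := Real.one_sub_inv_le_log_of_pos (div_pos hb0 hw.1)
    rw [Real.log_div hb0.ne' hw.1.ne', inv_div] at h
    have : b - w ≤ 1 - w / b := by
      rw [← sub_nonneg]
      have : 1 - w / b - (b - w) = (b - w) * (1 - b) / b := by field_simp
      rw [this]
      exact div_nonneg (mul_nonneg (by linarith [hw.2]) (by linarith)) hb0.le
    linarith
  have : w * (lossLevel b / b) = w / (b - 1 - Real.log b) := by
    rw [lossLevel]
    field_simp
  rw [this, lossLevel]
  exact div_le_div_of_nonneg_left hw.1.le hDb hmono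

/-- Bounds on `lossLevel p` from the series of `log ((1 + x) / (1 - x))`, where
`2 ^ j * p = (1 + x) / (1 - x)`. -/
theorem lossLevel_mem_Icc {p x A B : ℝ} (j : ℕ) (hp : 0 < p ∧ p < 1) (hx : 0 ≤ x ∧ x ≤ 1 / 3)
    (hpx : 2 ^ j * p * (1 - x) = 1 + x) (hAB : 0 ≤ A ∧ 0 ≤ B)
    (hA : A * (p - 1 + (j * 0.6931471808 - 2 * (x + x ^ 3 / 3 + x ^ 5 / 5 + x ^ 7 / 7 + x ^ 9 / 9
      + x ^ 11 / 11))) ≤ p)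
    (hB : p ≤ B * (p - 1 + (j * 0.6931471803 - 2 * (x + x ^ 3 / 3 + x ^ 5 / 5 + x ^ 7 / 7
      + x ^ 9 / 9 + x ^ 11 / 11 + x ^ 13 * (9 / 8))))) :
    A ≤ lossLevel p ∧ lossLevel p ≤ B := by
  have hD := lossLevel_denom_pos hp.1 hp.2
  have h1x : 0 < 1 - x := by linarith
  have hlog : Real.log ((1 + x) / (1 - x)) = j * Real.log 2 + Real.log p := by
    rw [← hpx, mul_div_assoc, div_self h1x.ne', mul_one, Real.log_mul (by positivity) hp.1.ne',
      Real.log_pow]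
  have hl := Real.sum_range_le_log_div hx.1 (by linarith) 6
  have hu := Real.log_div_le_sum_range_add hx.1 (by linarith) 6
  -- The factor 9/8 is 1 / (1 - x²) at the largest admissible x = 1/3.
  have hrem : x ^ (2 * 6 + 1) / (1 - x ^ 2) ≤ x ^ 13 * (9 / 8) := by
    rw [div_le_iff₀ (by nlinarith [hx.1])]
    have : 0 ≤ x ^ 13 := pow_nonneg hx.1 _
    nlinarith [mul_nonneg this (by nlinarith [hx.1] : 0 ≤ 9 / 8 * (1 - x ^ 2) - 1)]
  rw [hlog] at hl hu
  simp only [Finset.sum_range_succ, Finset.sum_range_zero] at hl hu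
  norm_num at hl hu
  have hj : (0 : ℝ) ≤ j := Nat.cast_nonneg j
  have hj1 := mul_le_mul_of_nonneg_left Real.log_two_gt_d9.le hj
  have hj2 := mul_le_mul_of_nonneg_left Real.log_two_lt_d9.le hj
  rw [lossLevel, le_div_iff₀ hD, div_le_iff₀ hD]
  constructor
  · refine (mul_le_mul_of_nonneg_left ?_ hAB.1).trans hA
    linarith
  · refine hB.trans (mul_le_mul_of_nonneg_left ?_ hAB.2)
    norm_num at hrem
    linarith

/-- The number 0.009195 is half the mesh 0.3678 / 20, where 0.3678 is just below 1/e. Here and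
below, `j` brings `2 ^ j * p` into [1, 2], and `x` solves `2 ^ j * p = (1 + x) / (1 - x)`. -/
theorem lossLevel_node_zero : 0.002485 ≤ lossLevel 0.009195 := by
  simpa using (lossLevel_mem_Icc (p := 0.009195) (x := 553/6803) (A := 0.002485)
    (B := 0.002488) 7 (by norm_num) (by norm_num) (by norm_num) (by norm_num) (by norm_num) (by norm_num)).1

theorem lossLevel_node_one : 0.010535 ≤ lossLevel (3 * 0.009195) ∧
    lossLevel (3 * 0.009195) ≤ 0.010538 :=
  lossLevel_mem_Icc (p := 3 * 0.009195) (x := 1196/4321) (A := 0.010535)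
    (B := 0.010538) 6 (by norm_num) (by norm_num) (by norm_num) (by norm_num) (by norm_num) (by norm_num)

theorem lossLevel_node_last : 0.933528 ≤ lossLevel (39 * 0.009195) ∧
    lossLevel (39 * 0.009195) ≤ 0.933531 :=
  lossLevel_mem_Icc (p := 39 * 0.009195) (x := 21721/121721) (A := 0.933528)
    (B := 0.933531) 2 (by norm_num) (by norm_num) (by norm_num) (by norm_num) (by norm_num) (by norm_num)

/-- These nodes serve twice: as midpoints of cells for the lower bound and as endpoints of shifted
cells for the upper bound. -/
theorem sum_lossLevel_nodes :
    6.024741 ≤ ∑ k ∈ Finset.range 19, lossLevel ((2 * k + 3) * 0.009195) ∧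
      ∑ k ∈ Finset.range 19, lossLevel ((2 * k + 3) * 0.009195) ≤ 6.024798 := by
  have h1 := lossLevel_node_one
  have h2 := lossLevel_mem_Icc (p := 5 * 0.009195) (x := 589/3089) (A := 0.021627)
    (B := 0.021630) 5 (by norm_num) (by norm_num) (by norm_num) (by norm_num) (by norm_num) (by norm_num)
  have h3 := lossLevel_mem_Icc (p := 7 * 0.009195) (x := 373/25373) (A := 0.035607)
    (B := 0.035610) 4 (by norm_num) (by norm_num) (by norm_num) (by norm_num) (by norm_num) (by norm_num)
  have h4 := lossLevel_mem_Icc (p := 9 * 0.009195) (x := 4051/29051) (A := 0.052554)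
    (B := 0.052557) 4 (by norm_num) (by norm_num) (by norm_num) (by norm_num) (by norm_num) (by norm_num)
  have h5 := lossLevel_mem_Icc (p := 11 * 0.009195) (x := 7729/32729) (A := 0.072642)
    (B := 0.072645) 4 (by norm_num) (by norm_num) (by norm_num) (by norm_num) (by norm_num) (by norm_num)
  have h6 := lossLevel_mem_Icc (p := 13 * 0.009195) (x := 11407/36407) (A := 0.096112)
    (B := 0.096115) 4 (by norm_num) (by norm_num) (by norm_num) (by norm_num) (by norm_num) (by norm_num)
  have h7 := lossLevel_mem_Icc (p := 15 * 0.009195) (x := 517/10517) (A := 0.123259)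
    (B := 0.123262) 3 (by norm_num) (by norm_num) (by norm_num) (by norm_num) (by norm_num) (by norm_num)
  have h8 := lossLevel_mem_Icc (p := 17 * 0.009195) (x := 6263/56263) (A := 0.154430)
    (B := 0.154433) 3 (by norm_num) (by norm_num) (by norm_num) (by norm_num) (by norm_num) (by norm_num)
  have h9 := lossLevel_mem_Icc (p := 19 * 0.009195) (x := 9941/59941) (A := 0.190027)
    (B := 0.190030) 3 (by norm_num) (by norm_num) (by norm_num) (by norm_num) (by norm_num) (by norm_num)
  have h10 := lossLevel_mem_Icc (p := 21 * 0.009195) (x := 13619/63619) (A := 0.230513)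
    (B := 0.230516) 3 (by norm_num) (by norm_num) (by norm_num) (by norm_num) (by norm_num) (by norm_num)
  have h11 := lossLevel_mem_Icc (p := 23 * 0.009195) (x := 17297/67297) (A := 0.276418)
    (B := 0.276421) 3 (by norm_num) (by norm_num) (by norm_num) (by norm_num) (by norm_num) (by norm_num)
  have h12 := lossLevel_mem_Icc (p := 25 * 0.009195) (x := 839/2839) (A := 0.328347)
    (B := 0.328350) 3 (by norm_num) (by norm_num) (by norm_num) (by norm_num) (by norm_num) (by norm_num)
  have h13 := lossLevel_mem_Icc (p := 27 * 0.009195) (x := 24653/74653) (A := 0.386991)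
    (B := 0.386994) 3 (by norm_num) (by norm_num) (by norm_num) (by norm_num) (by norm_num) (by norm_num)
  have h14 := lossLevel_mem_Icc (p := 29 * 0.009195) (x := 3331/103331) (A := 0.453143)
    (B := 0.453146) 2 (by norm_num) (by norm_num) (by norm_num) (by norm_num) (by norm_num) (by norm_num)
  have h15 := lossLevel_mem_Icc (p := 31 * 0.009195) (x := 7009/107009) (A := 0.527710)
    (B := 0.527713) 2 (by norm_num) (by norm_num) (by norm_num) (by norm_num) (by norm_num) (by norm_num)
  have h16 := lossLevel_mem_Icc (p := 33 * 0.009195) (x := 10687/110687) (A := 0.611734)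
    (B := 0.611737) 2 (by norm_num) (by norm_num) (by norm_num) (by norm_num) (by norm_num) (by norm_num)
  have h17 := lossLevel_mem_Icc (p := 35 * 0.009195) (x := 2873/22873) (A := 0.706418)
    (B := 0.706421) 2 (by norm_num) (by norm_num) (by norm_num) (by norm_num) (by norm_num) (by norm_num)
  have h18 := lossLevel_mem_Icc (p := 37 * 0.009195) (x := 18043/118043) (A := 0.813146)
    (B := 0.813149) 2 (by norm_num) (by norm_num) (by norm_num) (by norm_num) (by norm_num) (by norm_num)
  have h19 := lossLevel_node_last
  simp only [Finset.sum_range_succ, Finset.sum_range_zero]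
  norm_num at h1 h2 h3 h4 h5 h6 h7 h8 h9 h10 h11 h12 h13 h14 h15 h16 h17 h18 h19 ⊢
  constructor <;> linarith

theorem mem_Icc_zero_exp_neg_one {a : ℝ} (h : 0 ≤ a) (h' : a ≤ 0.3678) :
    a ∈ Set.Icc 0 (Real.exp (-1)) :=
  ⟨h, by linarith [Real.exp_neg_one_gt_d9]⟩

theorem integral_leastFraction_eq_add : ∫ q in (0 : ℝ)..1, leastFraction q =
    1 - Real.exp (-1) + ∫ w in (0 : ℝ)..Real.exp (-1), lossLevel w := by
  have he := Real.exp_pos (-1)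
  rw [integral_leastFraction, intervalIntegral.integral_sub (by simp)
    (intervalIntegrable_lossLevel ⟨le_rfl, he.le⟩ ⟨he.le, le_rfl⟩)]
  simp only [intervalIntegral.integral_const, smul_eq_mul, mul_one, sub_zero]
  ring

theorem le_integral_leastFraction : 0.743 ≤ ∫ q in (0 : ℝ)..1, leastFraction q := by
  have he := Real.exp_neg_one_lt_d9
  have he' := Real.exp_neg_one_gt_d9
  have hIe : Real.exp (-1) ∈ Set.Icc 0 (Real.exp (-1)) := ⟨by linarith, le_rfl⟩
  have hIb := mem_Icc_zero_exp_neg_one (a := 0.3678) (by norm_num) (by norm_num)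
  have hsum := intervalIntegral.sum_integral_adjacent_intervals (f := lossLevel) (μ := volume)
    (a := fun k : ℕ => (k : ℝ) * 0.01839) (n := 20) fun k hk => by
      have : (k : ℝ) ≤ 19 := by exact_mod_cast Nat.lt_succ_iff.1 hk
      refine intervalIntegrable_lossLevel (mem_Icc_zero_exp_neg_one (by positivity) ?_)
        (mem_Icc_zero_exp_neg_one (by positivity) ?_) <;> push_cast <;> linarith
  have hpieces : ∀ k ∈ Finset.range 20, 0.01839 * lossLevel ((2 * k + 1) * 0.009195) ≤
      ∫ w in ((k : ℝ) * 0.01839)..(((k + 1 : ℕ) : ℝ) * 0.01839), lossLevel w := by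
    intro k hk
    have hk' : (k : ℝ) ≤ 19 := by exact_mod_cast Nat.lt_succ_iff.1 (Finset.mem_range.1 hk)
    have hk0 : (0 : ℝ) ≤ k := Nat.cast_nonneg k
    have := midpoint_le_integral_lossLevel (a := (k : ℝ) * 0.01839)
      (b := ((k + 1 : ℕ) : ℝ) * 0.01839) (m := (2 * k + 1) * 0.009195) (by positivity)
      (by push_cast; linarith) (by push_cast; linarith) (by push_cast; ring)
      (by push_cast; nlinarith)
    refine le_trans (le_of_eq ?_) this
    push_cast
    ring
  have hle := Finset.sum_le_sum hpieces
  have h0 := lossLevel_node_zero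
  have hS := sum_lossLevel_nodes.1
  have hshift : ∑ k ∈ Finset.range 20, lossLevel ((2 * k + 1) * 0.009195) =
      ∑ k ∈ Finset.range 19, lossLevel ((2 * k + 3) * 0.009195) + lossLevel 0.009195 := by
    rw [Finset.sum_range_succ']
    congr 1
    · refine Finset.sum_congr rfl fun k _ => ?_
      push_cast
      ring_nf
    · norm_num
  rw [hsum, ← Finset.mul_sum, hshift, Nat.cast_zero, zero_mul] at hle
  rw [show ((20 : ℕ) : ℝ) * 0.01839 = 0.3678 by norm_num] at hle
  have hsplit := intervalIntegral.integral_add_adjacent_intervals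
    (intervalIntegrable_lossLevel ⟨le_rfl, hIe.1⟩ hIb) (intervalIntegrable_lossLevel hIb hIe)
  -- On the sliver left over below 1/e, monotonicity and the value at the last node suffice.
  have htail : (Real.exp (-1) - 0.3678) * 0.925 ≤
      ∫ w in (0.3678 : ℝ)..Real.exp (-1), lossLevel w := by
    have := intervalIntegral.integral_mono_on (f := fun _ => (0.925 : ℝ)) (by linarith)
      (by simp) (intervalIntegrable_lossLevel hIb hIe)
      fun w hw => lossLevel_node_last.1.trans' (by norm_num) |>.trans (lossLevel_monotoneOn
        (mem_Icc_zero_exp_neg_one (by norm_num) (by norm_num)) ⟨by linarith [hw.1], hw.2⟩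
        (by linarith [hw.1]))
    simpa using this
  rw [integral_leastFraction_eq_add]
  linarith

theorem integral_leastFraction_lt : ∫ q in (0 : ℝ)..1, leastFraction q < 0.744 := by
  have he := Real.exp_neg_one_lt_d9
  have he' := Real.exp_neg_one_gt_d9
  have hIe : Real.exp (-1) ∈ Set.Icc 0 (Real.exp (-1)) := ⟨by linarith, le_rfl⟩
  -- The trapezoids start at the second node: on the cell between the first two nodes the hypothesis
  -- `0.368 * b ≤ a * (1 - a)` fails.
  have hIa := mem_Icc_zero_exp_neg_one (a := 3 * 0.009195) (by norm_num) (by norm_num)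
  have hIb := mem_Icc_zero_exp_neg_one (a := 39 * 0.009195) (by norm_num) (by norm_num)
  have hsum := intervalIntegral.sum_integral_adjacent_intervals (f := lossLevel) (μ := volume)
    (a := fun k : ℕ => (2 * (k : ℝ) + 3) * 0.009195) (n := 18) fun k hk => by
      have : (k : ℝ) ≤ 17 := by exact_mod_cast Nat.lt_succ_iff.1 hk
      refine intervalIntegrable_lossLevel (mem_Icc_zero_exp_neg_one (by positivity) ?_)
        (mem_Icc_zero_exp_neg_one (by positivity) ?_) <;> push_cast <;> linarith
  have hpieces : ∀ k ∈ Finset.range 18,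
      ∫ w in ((2 * (k : ℝ) + 3) * 0.009195)..((2 * ((k + 1 : ℕ) : ℝ) + 3) * 0.009195),
        lossLevel w ≤ 0.009195 * (lossLevel ((2 * (k : ℝ) + 3) * 0.009195) +
          lossLevel ((2 * ((k + 1 : ℕ) : ℝ) + 3) * 0.009195)) := by
    intro k hk
    have hk' : (k : ℝ) ≤ 17 := by exact_mod_cast Nat.lt_succ_iff.1 (Finset.mem_range.1 hk)
    have hk0 : (0 : ℝ) ≤ k := Nat.cast_nonneg k
    have := integral_lossLevel_le_trapezoid (a := (2 * (k : ℝ) + 3) * 0.009195)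
      (b := (2 * ((k + 1 : ℕ) : ℝ) + 3) * 0.009195) (by positivity)
      (by push_cast; linarith) (by push_cast; linarith) (by push_cast; nlinarith)
    refine this.trans (le_of_eq ?_)
    push_cast
    ring
  have hle := Finset.sum_le_sum hpieces
  have h1 := lossLevel_node_one
  have h19 := lossLevel_node_last
  have hS := sum_lossLevel_nodes.2
  have hS1 := Finset.sum_range_succ (fun k : ℕ => lossLevel ((2 * k + 3) * 0.009195)) 18
  have hS2 := Finset.sum_range_succ' (fun k : ℕ => lossLevel ((2 * k + 3) * 0.009195)) 18
  rw [show (2 * ((18 : ℕ) : ℝ) + 3) * 0.009195 = 39 * 0.009195 by norm_num] at hS1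
  rw [show (2 * ((0 : ℕ) : ℝ) + 3) * 0.009195 = 3 * 0.009195 by norm_num] at hS2
  rw [hsum, ← Finset.mul_sum, Finset.sum_add_distrib,
    show (2 * ((18 : ℕ) : ℝ) + 3) * 0.009195 = 39 * 0.009195 by norm_num,
    show (2 * ((0 : ℕ) : ℝ) + 3) * 0.009195 = 3 * 0.009195 by norm_num] at hle
  have hfirst := integral_zero_lossLevel_le (b := 3 * 0.009195) (by norm_num) (by linarith)
  have hlast := integral_lossLevel_le_trapezoid (a := 39 * 0.009195) (by norm_num)
    (by linarith) le_rfl (by linarith)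
  rw [lossLevel_exp_neg_one] at hlast
  have hlast' : (Real.exp (-1) - 39 * 0.009195) * ((lossLevel (39 * 0.009195) + 1) / 2) ≤
      (Real.exp (-1) - 39 * 0.009195) * 0.967 :=
    mul_le_mul_of_nonneg_left (by linarith [h19.2]) (by linarith)
  have hsplit := intervalIntegral.integral_add_adjacent_intervals
    (intervalIntegrable_lossLevel ⟨le_rfl, hIe.1⟩ hIa) (intervalIntegrable_lossLevel hIa hIe)
  have hsplit' := intervalIntegral.integral_add_adjacent_intervals
    (intervalIntegrable_lossLevel hIa hIb) (intervalIntegrable_lossLevel hIb hIe)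
  rw [integral_leastFraction_eq_add]
  linarith

/-! ### Distribution functions on the line, stochastic dominance and correlation. -/

section RealLine

/-- By inner regularity it is enough to treat compact subsets, and a compact set lies below its
greatest element. -/
theorem measure_le_of_forall_measure_Iic_le {m : Measure ℝ} [IsFiniteMeasure m] {S : Set ℝ}
    (hS : MeasurableSet S) {C : ENNReal} (h : ∀ z ∈ S, m (Set.Iic z) ≤ C) : m S ≤ C := by
  rw [hS.measure_eq_iSup_isCompact_of_ne_top (measure_ne_top m S)]
  refine iSup₂_le fun K hKS => iSup_le fun hK => ?_
  rcases K.eq_empty_or_nonempty with rfl | hne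
  · simp
  · obtain ⟨z, hz, hmax⟩ := hK.exists_isGreatest hne
    exact (measure_mono hmax).trans (h z (hKS hz))

theorem measure_le_of_forall_measure_Ici_le {m : Measure ℝ} [IsFiniteMeasure m] {S : Set ℝ}
    (hS : MeasurableSet S) {C : ENNReal} (h : ∀ z ∈ S, m (Set.Ici z) ≤ C) : m S ≤ C := by
  rw [hS.measure_eq_iSup_isCompact_of_ne_top (measure_ne_top m S)]
  refine iSup₂_le fun K hKS => iSup_le fun hK => ?_
  rcases K.eq_empty_or_nonempty with rfl | hne
  · simp
  · obtain ⟨z, hz, hmin⟩ := hK.exists_isLeast hne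
    exact (measure_mono hmin).trans (h z (hKS hz))

theorem monotone_measureReal_Iic (m : Measure ℝ) [IsFiniteMeasure m] :
    Monotone fun z => m.real (Set.Iic z) :=
  fun _ _ h => measureReal_mono (Set.Iic_subset_Iic.2 h)

theorem ae_measureReal_Iic_pos (m : Measure ℝ) [IsFiniteMeasure m] :
    ∀ᵐ z ∂m, 0 < m.real (Set.Iic z) := by
  have hmeas := (monotone_measureReal_Iic m).measurable
  have : m {z | m.real (Set.Iic z) = 0} ≤ 0 :=
    measure_le_of_forall_measure_Iic_le (hmeas (measurableSet_singleton 0)) fun z hz =>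
      ((measureReal_eq_zero_iff).1 hz).le
  rw [ae_iff]
  refine measure_mono_null (fun z hz => ?_) (nonpos_iff_eq_zero.1 this)
  exact le_antisymm (not_lt.1 hz) measureReal_nonneg

theorem ae_measureReal_Iic_lt_one (m : Measure ℝ) [IsProbabilityMeasure m] [NullSingletonClass m] :
    ∀ᵐ z ∂m, m.real (Set.Iic z) < 1 := by
  have hmeas := (monotone_measureReal_Iic m).measurable
  have : m {z | m.real (Set.Iic z) = 1} ≤ 0 :=
    measure_le_of_forall_measure_Ici_le (hmeas (measurableSet_singleton 1)) fun z hz => by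
      have hz' : m.real (Set.Iic z) = 1 := hz
      have := probReal_compl_eq_one_sub (μ := m) (measurableSet_Iic (a := z))
      rw [hz', sub_self, Set.compl_Iic, measureReal_eq_zero_iff] at this
      rw [← measure_congr Ioi_ae_eq_Ici, this]
  rw [ae_iff]
  refine measure_mono_null (fun z hz => ?_) (nonpos_iff_eq_zero.1 this)
  exact le_antisymm measureReal_le_one (not_lt.1 hz)

/-- If `m` is supported on `(x, 1]` and stochastically dominates the Lebesgue measure there, then
antitone functions have a smaller `m`-integral. -/
theorem lintegral_le_of_antitoneOn {m : Measure ℝ} {x : ℝ}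
    (hm : ∀ s, x ≤ s → m (Set.Iic s) ≤ ENNReal.ofReal (s - x)) (hm1 : m (Set.Ioi 1) = 0)
    {g : ℝ → ℝ} (hg : AntitoneOn g (Set.Ioc x 1)) (hg0 : ∀ s ∈ Set.Ioc x 1, 0 ≤ g s) :
    ∫⁻ s, ENNReal.ofReal (g s) ∂m ≤ ∫⁻ s in Set.Ioc x 1, ENNReal.ofReal (g s) := by
  have hmr : m.restrict (Set.Ioc x 1) = m := by
    refine Measure.restrict_eq_self_of_ae_mem ?_
    have hx0 : m (Set.Iic x) = 0 := by simpa using hm x le_rfl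
    rw [ae_iff]
    refine measure_mono_null (fun s hs => ?_) (measure_union_null hx0 hm1)
    simp only [Set.mem_Ioc, not_and_or, not_lt, not_le, Set.mem_ofPred_eq] at hs
    exact hs
  rw [← hmr, lintegral_eq_lintegral_meas_lt, lintegral_eq_lintegral_meas_lt]
  rotate_left
  · filter_upwards [ae_restrict_mem measurableSet_Ioc] with s hs using hg0 s hs
  · exact aemeasurable_restrict_of_antitoneOn measurableSet_Ioc hg
  · filter_upwards [ae_restrict_mem measurableSet_Ioc] with s hs using hg0 s hs
  · exact aemeasurable_restrict_of_antitoneOn measurableSet_Ioc hg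
  refine lintegral_mono fun t => ?_
  simp only
  rw [Measure.restrict_apply' measurableSet_Ioc, Measure.restrict_apply' measurableSet_Ioc]
  -- A superlevel set of an antitone function is an initial interval up to its endpoint, and those
  -- are exactly the sets that `hm` compares.
  set T := {s | t < g s} ∩ Set.Ioc x 1 with hT
  rcases T.eq_empty_or_nonempty with h | hne
  · simp [h]
  have hbdd : BddAbove T := ⟨1, fun s hs => hs.2.2⟩
  obtain ⟨s₀, hs₀⟩ := hne
  have hx : x ≤ sSup T := hs₀.2.1.le.trans (le_csSup hbdd hs₀)
  calc m T ≤ m (Set.Iic (sSup T)) := measure_mono fun s hs => le_csSup hbdd hs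
    _ ≤ ENNReal.ofReal (sSup T - x) := hm _ hx
    _ = volume (Set.Ioo x (sSup T)) := Real.volume_Ioo.symm
    _ ≤ volume T := measure_mono fun s hs => by
      obtain ⟨s', hs', hlt⟩ := exists_lt_of_lt_csSup ⟨s₀, hs₀⟩ hs.2
      have hsI : s ∈ Set.Ioc x 1 := ⟨hs.1, hlt.le.trans hs'.2.2⟩
      exact ⟨hs'.1.trans_le (hg hsI hs'.2 hlt.le), hsI⟩

/-- The points where the distribution function is at most `s` have mass at most `s` and include all
of `Iic b`, whose mass is subtracted. Atoms are harmless: they only push the distribution function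
up. -/
theorem map_measureReal_Iic_restrict_Ioi_le (ν : Measure ℝ) [IsFiniteMeasure ν] {b s : ℝ}
    (hs : ν.real (Set.Iic b) ≤ s) :
    (ν.restrict (Set.Ioi b)).map (fun z => ν.real (Set.Iic z)) (Set.Iic s) ≤
      ENNReal.ofReal (s - ν.real (Set.Iic b)) := by
  have hmeas := (monotone_measureReal_Iic ν).measurable
  rw [Measure.map_apply hmeas measurableSet_Iic,
    Measure.restrict_apply (hmeas measurableSet_Iic)]
  set S := (fun z => ν.real (Set.Iic z)) ⁻¹' Set.Iic s
  have hS : MeasurableSet S := hmeas measurableSet_Iic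
  have h1 : ν S ≤ ENNReal.ofReal s := measure_le_of_forall_measure_Iic_le hS fun z hz => by
    rw [← ofReal_measureReal]
    exact ENNReal.ofReal_le_ofReal hz
  have hsub : Set.Iic b ⊆ S := fun z hz => (monotone_measureReal_Iic ν hz).trans hs
  have h2 : S ∩ Set.Ioi b = S \ Set.Iic b := by
    ext z
    simp
  rw [h2, measure_sdiff hsub measurableSet_Iic.nullMeasurableSet (measure_ne_top _ _),
    ENNReal.ofReal_sub _ measureReal_nonneg, ofReal_measureReal]
  exact tsub_le_tsub_right h1 _

theorem map_measureReal_Iic_le (ν : Measure ℝ) [IsFiniteMeasure ν] (s : ℝ) :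
    ν.map (fun z => ν.real (Set.Iic z)) (Set.Iic s) ≤ ENNReal.ofReal s := by
  have hmeas := (monotone_measureReal_Iic ν).measurable
  rw [Measure.map_apply hmeas measurableSet_Iic]
  refine measure_le_of_forall_measure_Iic_le (hmeas measurableSet_Iic) fun z hz => ?_
  rw [← ofReal_measureReal]
  exact ENNReal.ofReal_le_ofReal hz

theorem map_measureReal_Iic_Ioi_one (ν ν' : Measure ℝ) [IsProbabilityMeasure ν] :
    ν'.map (fun z => ν.real (Set.Iic z)) (Set.Ioi 1) = 0 := by
  rw [Measure.map_apply (monotone_measureReal_Iic ν).measurable measurableSet_Ioi]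
  convert measure_empty (μ := ν')
  ext z
  simp [measureReal_le_one]

theorem integral_loss_eq {q x : ℝ} (hq : q ∈ Set.Icc (0 : ℝ) 1) (hq1 : q < 1) (hx : 0 < x)
    (hx1 : x ≤ 1) :
    ∫ s in x..1, (1 - q) * x / (s - q * x) = 1 - welfareFraction q x := by
  have hpos : ∀ s, x ≤ s → 0 < s - q * x := fun s hs => by nlinarith
  have hderiv : ∀ s ∈ Set.uIcc x 1, HasDerivAt (fun s => (1 - q) * x * Real.log (s - q * x))
      ((1 - q) * x / (s - q * x)) s := by
    intro s hs
    rw [Set.uIcc_of_le hx1] at hs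
    have := (((hasDerivAt_id s).sub_const (q * x)).log (hpos s hs.1).ne').const_mul ((1 - q) * x)
    rw [mul_one_div] at this
    exact this
  rw [intervalIntegral.integral_eq_sub_of_hasDerivAt hderiv]
  · rw [welfareFraction_eq hq ⟨hx.le, hx1⟩, Real.negMulLog]
    ring_nf
  · refine ContinuousOn.intervalIntegrable ?_
    rw [Set.uIcc_of_le hx1]
    exact continuousOn_const.div (by fun_prop) fun s hs => (hpos s hs.1).ne'

/-- The loss is antitone in the value of the distribution function, so one-sided dominance over the
uniform law is enough and `ν` may have atoms. -/
theorem lintegral_loss_le (ν : Measure ℝ) [IsProbabilityMeasure ν] {q b : ℝ}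
    (hq : q ∈ Set.Icc (0 : ℝ) 1) (hq1 : q < 1) (hb : 0 < ν.real (Set.Iic b)) :
    ∫⁻ z in Set.Ioi b, ENNReal.ofReal ((1 - q) * ν.real (Set.Iic b) /
        (ν.real (Set.Iic z) - q * ν.real (Set.Iic b))) ∂ν ≤
      ENNReal.ofReal (1 - welfareFraction q (ν.real (Set.Iic b))) := by
  set x := ν.real (Set.Iic b) with hx
  have hx1 : x ≤ 1 := measureReal_le_one
  have hs : 0 < 1 - q := by linarith
  have hpos : ∀ s, x ≤ s → 0 < s - q * x := fun s hs => by nlinarith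
  have hmeas := (monotone_measureReal_Iic ν).measurable
  have h0 : ∀ s, x ≤ s → 0 ≤ (1 - q) * x / (s - q * x) :=
    fun s hs => div_nonneg (by positivity) (hpos s hs).le
  have h := lintegral_le_of_antitoneOn (m := (ν.restrict (Set.Ioi b)).map
      (fun z => ν.real (Set.Iic z))) (x := x) (g := fun s => (1 - q) * x / (s - q * x))
    (fun s hs => map_measureReal_Iic_restrict_Ioi_le ν hs) (map_measureReal_Iic_Ioi_one ν _)
    (fun s hs t _ hst => div_le_div_of_nonneg_left (by positivity) (hpos s hs.1.le) (by linarith))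
    (fun s hs => h0 s hs.1.le)
  rw [lintegral_map (by fun_prop) hmeas] at h
  refine h.trans (le_of_eq ?_)
  rw [← integral_loss_eq hq hq1 hb hx1, intervalIntegral.integral_of_le hx1,
    ofReal_integral_eq_lintegral_ofReal]
  · rw [← IntegrableOn, ← intervalIntegrable_iff_integrableOn_Ioc_of_le hx1]
    refine ContinuousOn.intervalIntegrable ?_
    rw [Set.uIcc_of_le hx1]
    exact continuousOn_const.div (by fun_prop) fun s hs => (hpos s hs.1).ne'
  · filter_upwards [ae_restrict_mem measurableSet_Ioc] with s hs using h0 s hs.1.le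

theorem ofReal_welfareFraction_le_lintegral (ν : Measure ℝ) [IsProbabilityMeasure ν] {q b : ℝ}
    (hq : q ∈ Set.Icc (0 : ℝ) 1) (hq1 : q < 1) (hb : 0 < ν.real (Set.Iic b)) :
    ENNReal.ofReal (welfareFraction q (ν.real (Set.Iic b))) ≤
      ∫⁻ z, ENNReal.ofReal (1 - if z ≤ b then 0 else (1 - q) * ν.real (Set.Iic b) /
        (ν.real (Set.Iic z) - q * ν.real (Set.Iic b))) ∂ν := by
  set x := ν.real (Set.Iic b) with hx
  have hmeas := (monotone_measureReal_Iic ν).measurable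
  set Λ : ℝ → ℝ := fun z => if z ≤ b then 0 else (1 - q) * x / (ν.real (Set.Iic z) - q * x) with hΛ
  have hΛm : Measurable Λ := Measurable.ite measurableSet_Iic measurable_const (by fun_prop)
  have hL := lintegral_loss_le ν hq hq1 hb
  rw [← hx] at hL
  have hΛint : ∫⁻ z, ENNReal.ofReal (Λ z) ∂ν ≤ ENNReal.ofReal (1 - welfareFraction q x) := by
    refine le_trans (le_of_eq ?_) hL
    rw [← lintegral_indicator measurableSet_Ioi]
    refine lintegral_congr fun z => ?_
    by_cases hz : z ≤ b <;> simp [hΛ, hz, Set.indicator, not_lt.2, not_le.1]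
  have hone : 1 ≤ ∫⁻ z, ENNReal.ofReal (1 - Λ z) ∂ν + ∫⁻ z, ENNReal.ofReal (Λ z) ∂ν := by
    rw [← lintegral_add_left (by fun_prop)]
    calc (1 : ENNReal) = ∫⁻ _, 1 ∂ν := by simp
      _ ≤ _ := lintegral_mono fun z => by
        rw [← ENNReal.ofReal_one]
        refine le_trans (ENNReal.ofReal_le_ofReal ?_) ENNReal.ofReal_add_le
        linarith
  have hw1 : welfareFraction q x ≤ 1 := by
    have : 0 ≤ ∫ s in x..1, (1 - q) * x / (s - q * x) :=
      intervalIntegral.integral_nonneg measureReal_le_one fun s hs =>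
        div_nonneg (mul_nonneg (by linarith) hb.le) (by nlinarith [hs.1])
    rw [integral_loss_eq hq hq1 hb measureReal_le_one] at this
    linarith
  have hsum : 1 ≤ ∫⁻ z, ENNReal.ofReal (1 - Λ z) ∂ν + ENNReal.ofReal (1 - welfareFraction q x) :=
    hone.trans (by gcongr)
  have hw : ENNReal.ofReal (welfareFraction q x) =
      1 - ENNReal.ofReal (1 - welfareFraction q x) := by
    rw [← ENNReal.ofReal_one, ← ENNReal.ofReal_sub _ (by linarith), sub_sub_cancel]
  rw [hw]
  exact tsub_le_iff_right.2 hsum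

theorem monotone_leastFraction_comp (ν : Measure ℝ) [IsProbabilityMeasure ν] :
    Monotone fun z => leastFraction (ν.real (Set.Iic z)) :=
  fun _ _ h => leastFraction_monotoneOn ⟨measureReal_nonneg, measureReal_le_one⟩
    ⟨measureReal_nonneg, measureReal_le_one⟩ (monotone_measureReal_Iic ν h)

/-- Dominance over the uniform law is applied to the nonnegative antitone function `1 -
leastFraction` and then complemented. -/
theorem ofReal_integral_leastFraction_le (ν : Measure ℝ) [IsProbabilityMeasure ν] :
    ENNReal.ofReal (∫ q in (0 : ℝ)..1, leastFraction q) ≤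
      ∫⁻ z, ENNReal.ofReal (leastFraction (ν.real (Set.Iic z))) ∂ν := by
  have hmeas := (monotone_measureReal_Iic ν).measurable
  have hmono := monotone_leastFraction_comp ν
  have hint := intervalIntegrable_leastFraction (a := 0) (b := 1) (by simp) (by simp)
  have hanti : AntitoneOn (fun q => 1 - leastFraction q) (Set.Ioc 0 1) := fun s hs t ht h =>
    sub_le_sub_left (leastFraction_monotoneOn (Set.Ioc_subset_Icc_self hs)
      (Set.Ioc_subset_Icc_self ht) h) 1
  have hnn : ∀ s ∈ Set.Ioc (0 : ℝ) 1, 0 ≤ 1 - leastFraction s := fun s hs =>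
    sub_nonneg.2 (leastFraction_le_one (Set.Ioc_subset_Icc_self hs))
  have h := lintegral_le_of_antitoneOn (m := ν.map (fun z => ν.real (Set.Iic z))) (x := 0)
    (fun s _ => by simpa using map_measureReal_Iic_le ν s) (map_measureReal_Iic_Ioi_one ν _)
    hanti hnn
  have hle1 : ∫ q in (0 : ℝ)..1, leastFraction q ≤ 1 := by
    have := intervalIntegral.integral_mono_on (g := fun _ => (1 : ℝ)) zero_le_one hint (by simp)
      fun q hq => leastFraction_le_one hq
    simpa using this
  have hR : ∫⁻ s in Set.Ioc (0 : ℝ) 1, ENNReal.ofReal (1 - leastFraction s) =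
      ENNReal.ofReal (1 - ∫ q in (0 : ℝ)..1, leastFraction q) := by
    have e : 1 - ∫ q in (0 : ℝ)..1, leastFraction q =
        ∫ q in (0 : ℝ)..1, (1 - leastFraction q) := by
      rw [intervalIntegral.integral_sub (by simp) hint]
      simp
    rw [e, intervalIntegral.integral_of_le zero_le_one, ofReal_integral_eq_lintegral_ofReal]
    · exact (intervalIntegrable_iff_integrableOn_Ioc_of_le zero_le_one).1
        ((intervalIntegrable_const (c := (1 : ℝ))).sub hint)
    · filter_upwards [ae_restrict_mem measurableSet_Ioc] with s hs using hnn s hs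
  have hM : ∫⁻ s, ENNReal.ofReal (1 - leastFraction s) ∂ν.map (fun z => ν.real (Set.Iic z)) =
      ∫⁻ z, ENNReal.ofReal (1 - leastFraction (ν.real (Set.Iic z))) ∂ν := by
    refine lintegral_map' ?_ hmeas.aemeasurable
    have hmr : (ν.map (fun z => ν.real (Set.Iic z))).restrict (Set.Icc 0 1) =
        ν.map (fun z => ν.real (Set.Iic z)) := by
      refine Measure.restrict_eq_self_of_ae_mem ?_
      exact (ae_map_iff hmeas.aemeasurable measurableSet_Icc).2
        (ae_of_all _ fun z => ⟨measureReal_nonneg, measureReal_le_one⟩)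
    rw [← hmr]
    exact ((aemeasurable_restrict_of_monotoneOn measurableSet_Icc
      leastFraction_monotoneOn).const_sub 1).ennreal_ofReal
  rw [hR, hM] at h
  have hone : 1 ≤ ∫⁻ z, ENNReal.ofReal (leastFraction (ν.real (Set.Iic z))) ∂ν +
      ∫⁻ z, ENNReal.ofReal (1 - leastFraction (ν.real (Set.Iic z))) ∂ν := by
    rw [← lintegral_add_left hmono.measurable.ennreal_ofReal]
    calc (1 : ENNReal) = ∫⁻ _, 1 ∂ν := by simp
      _ ≤ _ := lintegral_mono fun z => by
        rw [← ENNReal.ofReal_one]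
        refine le_trans (ENNReal.ofReal_le_ofReal ?_) ENNReal.ofReal_add_le
        linarith
  have hsum := hone.trans (add_le_add_right h _)
  have hw : ENNReal.ofReal (∫ q in (0 : ℝ)..1, leastFraction q) =
      1 - ENNReal.ofReal (1 - ∫ q in (0 : ℝ)..1, leastFraction q) := by
    rw [← ENNReal.ofReal_one, ← ENNReal.ofReal_sub _ (by linarith), sub_sub_cancel]
  rw [hw]
  exact tsub_le_iff_right.2 hsum

/-- Chebyshev's correlation inequality. -/
theorem lintegral_mul_lintegral_le_of_monotone (ν : Measure ℝ) [IsProbabilityMeasure ν]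
    {f g : ℝ → ENNReal} (hf : Monotone f) (hg : Monotone g) :
    (∫⁻ z, f z ∂ν) * ∫⁻ z, g z ∂ν ≤ ∫⁻ z, f z * g z ∂ν := by
  have hfm := hf.measurable
  have hgm := hg.measurable
  -- This is the rearrangement inequality; writing the larger values as sums avoids subtraction in
  -- `ENNReal`. Integrating it over two independent copies gives the claim.
  have key : ∀ {x y : ℝ}, x ≤ y → f x * g y + f y * g x ≤ f x * g x + f y * g y := by
    intro x y h
    obtain ⟨d, hd⟩ := le_iff_exists_add.1 (hf h)
    obtain ⟨e, he⟩ := le_iff_exists_add.1 (hg h)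
    rw [hd, he]
    exact le_iff_exists_add.2 ⟨d * e, by ring⟩
  have hpt : ∀ x y, f x * g y + f y * g x ≤ f x * g x + f y * g y := by
    intro x y
    rcases le_total x y with h | h
    · exact key h
    · rw [add_comm (f x * g y), add_comm (f x * g x)]
      exact key h
  have h2 : ∫⁻ x, ∫⁻ y, (f x * g y + f y * g x) ∂ν ∂ν ≤
      ∫⁻ x, ∫⁻ y, (f x * g x + f y * g y) ∂ν ∂ν :=
    lintegral_mono fun x => lintegral_mono fun y => hpt x y
  have e1 : ∫⁻ x, ∫⁻ y, (f x * g y + f y * g x) ∂ν ∂ν =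
      2 * ((∫⁻ z, f z ∂ν) * ∫⁻ z, g z ∂ν) := by
    have : ∀ x, ∫⁻ y, (f x * g y + f y * g x) ∂ν =
        f x * (∫⁻ z, g z ∂ν) + (∫⁻ z, f z ∂ν) * g x := fun x => by
      rw [lintegral_add_left (by fun_prop), lintegral_const_mul _ hgm, lintegral_mul_const _ hfm]
    simp_rw [this]
    rw [lintegral_add_left (by fun_prop), lintegral_const_mul _ hgm, lintegral_mul_const _ hfm]
    ring
  have e2 : ∫⁻ x, ∫⁻ y, (f x * g x + f y * g y) ∂ν ∂ν = 2 * ∫⁻ z, f z * g z ∂ν := by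
    have : ∀ x, ∫⁻ y, (f x * g x + f y * g y) ∂ν = f x * g x + ∫⁻ z, f z * g z ∂ν := fun x => by
      rw [lintegral_add_left (by fun_prop)]
      simp
    simp_rw [this]
    rw [lintegral_add_left (by fun_prop)]
    simp [two_mul]
  rw [e1, e2] at h2
  exact (ENNReal.mul_le_mul_iff_right (by simp) (by simp)).1 h2

end RealLine

/-! ### Resampling one coordinate of a product measure. -/

section Resampling

variable {n : ℕ} (μ : Fin n → Measure ℝ) [∀ i, IsProbabilityMeasure (μ i)]

theorem measurable_update_prod (i : Fin n) :
    Measurable fun p : ℝ × (Fin n → ℝ) => Function.update p.2 i p.1 := by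
  refine measurable_pi_lambda _ fun j => ?_
  by_cases h : j = i
  · subst h
    simpa using measurable_fst
  · simp only [Function.update_of_ne h]
    fun_prop

theorem measure_pi_forall_ne (i : Fin n) (S : Fin n → Set ℝ) :
    Measure.pi μ {w | ∀ j, j ≠ i → w j ∈ S j} = ∏ j ∈ Finset.univ.erase i, μ j (S j) := by
  rw [← Measure.pi_pi_finset]
  congr 1
  ext w
  simp [Set.mem_pi]

theorem measureReal_pi_forall_ne (i : Fin n) (S : Fin n → Set ℝ) :
    (Measure.pi μ).real {w | ∀ j, j ≠ i → w j ∈ S j} =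
      ∏ j ∈ Finset.univ.erase i, (μ j).real (S j) := by
  simp only [measureReal_def, measure_pi_forall_ne, ENNReal.toReal_prod]

/-- Resampling one coordinate does not change a product of probability measures. -/
theorem measurePreserving_update (i : Fin n) :
    MeasurePreserving (fun p : ℝ × (Fin n → ℝ) => Function.update p.2 i p.1)
      ((μ i).prod (Measure.pi μ)) (Measure.pi μ) := by
  refine ⟨measurable_update_prod i, ?_⟩
  refine (Measure.pi_eq fun s hs => ?_).symm
  rw [Measure.map_apply (measurable_update_prod i) (MeasurableSet.univ_pi hs)]
  have : (fun p : ℝ × (Fin n → ℝ) => Function.update p.2 i p.1) ⁻¹' Set.univ.pi s =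
      s i ×ˢ {w | ∀ j, j ≠ i → w j ∈ s j} := by
    ext p
    simp only [Set.mem_preimage, Set.mem_univ_pi, Set.mem_prod]
    constructor
    · intro h
      refine ⟨by simpa using h i, fun j hj => by simpa [Function.update_of_ne hj] using h j⟩
    · rintro ⟨h1, h2⟩ j
      by_cases hj : j = i
      · subst hj
        simpa using h1
      · simpa [Function.update_of_ne hj] using h2 j hj
  rw [this, Measure.prod_prod, measure_pi_forall_ne,
    Finset.mul_prod_erase Finset.univ (fun j => μ j (s j)) (Finset.mem_univ i)]

theorem lintegral_pi_eq_resample (i : Fin n) {f : (Fin n → ℝ) → ENNReal} (hf : Measurable f) :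
    ∫⁻ w, f w ∂Measure.pi μ = ∫⁻ t, ∫⁻ w, f (Function.update w i t) ∂Measure.pi μ ∂μ i := by
  rw [← (measurePreserving_update μ i).lintegral_comp hf, lintegral_prod]
  exact (hf.comp (measurable_update_prod i)).aemeasurable

theorem ae_ae_update_of_ae (i : Fin n) {p : (Fin n → ℝ) → Prop} (h : ∀ᵐ w ∂Measure.pi μ, p w) :
    ∀ᵐ t ∂μ i, ∀ᵐ w ∂Measure.pi μ, p (Function.update w i t) :=
  Measure.ae_ae_of_ae_prod ((measurePreserving_update μ i).quasiMeasurePreserving.ae h)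

theorem ae_of_ae_ae_update (i : Fin n) {p : (Fin n → ℝ) → Prop}
    (hp : MeasurableSet {w | p w})
    (h : ∀ᵐ t ∂μ i, ∀ᵐ w ∂Measure.pi μ, p (Function.update w i t)) :
    ∀ᵐ w ∂Measure.pi μ, p w := by
  rw [← (measurePreserving_update μ i).map_eq,
    ae_map_iff (measurable_update_prod i).aemeasurable hp]
  exact (Measure.ae_prod_iff_ae_ae (measurable_update_prod i hp)).2 h

theorem ae_pi_forall {p : Fin n → ℝ → Prop} (h : ∀ i, ∀ᵐ t ∂μ i, p i t) :
    ∀ᵐ w ∂Measure.pi μ, ∀ i, p i (w i) :=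
  ae_all_iff.2 fun i => (measurePreserving_eval μ i).quasiMeasurePreserving.ae (h i)

theorem ae_pi_ne [∀ i, NullSingletonClass (μ i)] :
    ∀ᵐ w ∂Measure.pi μ, ∀ i j, j ≠ i → w j ≠ w i := by
  refine ae_all_iff.2 fun i => ae_all_iff.2 fun j => ?_
  by_cases hj : j = i
  · simp [hj]
  refine ae_of_ae_ae_update μ j ?_ ?_
  · have : {w : Fin n → ℝ | j ≠ i → w j ≠ w i} = {w | w j = w i}ᶜ := by
      ext w
      simp [hj]
    rw [this]
    exact (measurableSet_eq_fun (measurable_pi_apply j) (measurable_pi_apply i)).compl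
  · have hm : MeasurableSet {p : ℝ × (Fin n → ℝ) | p.1 ≠ p.2 i} :=
      (measurableSet_eq_fun (by fun_prop) (by fun_prop)).compl
    have h : ∀ᵐ w ∂Measure.pi μ, ∀ᵐ t ∂μ j, t ≠ w i :=
      ae_of_all _ fun w => by simp [ae_iff]
    have := (Measure.ae_ae_comm (μ := μ j) (ν := Measure.pi μ) (p := fun t w => t ≠ w i) hm).2 h
    filter_upwards [this] with t ht
    filter_upwards [ht] with w hw _
    simpa [Function.update_of_ne (Ne.symm hj)] using hw

end Resampling

/-! ### Win probabilities and best responses. -/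

namespace FirstPriceAuction

variable {n : ℕ} (A : FirstPriceAuction n)

theorem alloc_eq_one {b : Fin n → ℝ} {i : Fin n} (h : ∀ j, j ≠ i → b j < b i) :
    A.alloc b i = 1 := by
  rw [← A.sum_alloc b]
  refine (Finset.sum_eq_single_of_mem i (Finset.mem_univ i) fun j _ hj => ?_).symm
  by_contra hne
  have := A.highest_of_alloc_pos b j (lt_of_le_of_ne (A.alloc_nonneg b j) (Ne.symm hne)) i
  exact absurd (h j hj) (not_lt.2 this)

theorem alloc_le_one (b : Fin n → ℝ) (i : Fin n) : A.alloc b i ≤ 1 := by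
  rw [← A.sum_alloc b]
  exact Finset.single_le_sum (fun j _ => A.alloc_nonneg b j) (Finset.mem_univ i)

/-- If every possible winner has value at least `a`, then so has the winner on average. -/
theorem ofReal_le_sum_mul_alloc {b w : Fin n → ℝ} {a : ℝ}
    (h : ∀ k, 0 < A.alloc b k → a ≤ w k) :
    ENNReal.ofReal a ≤ ∑ k, ENNReal.ofReal (w k * A.alloc b k) := by
  have hle : a ≤ ∑ k, w k * A.alloc b k := by
    calc a = ∑ k, a * A.alloc b k := by rw [← Finset.mul_sum, A.sum_alloc, mul_one]
      _ ≤ _ := Finset.sum_le_sum fun k _ => by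
        rcases (A.alloc_nonneg b k).eq_or_lt with h0 | h0
        · simp [← h0]
        · exact mul_le_mul_of_nonneg_right (h k h0) h0.le
  refine (ENNReal.ofReal_le_ofReal hle).trans ?_
  exact Finset.le_sum_of_subadditive _ ENNReal.ofReal_zero.le (fun _ _ => ENNReal.ofReal_add_le) _ _

variable (μ : Fin n → Measure ℝ) (β : Fin n → ℝ → ℝ)

/-- The distribution function of the bid of agent `j`. -/
noncomputable def bidCdf (j : Fin n) (z : ℝ) : ℝ := (μ j).real {t | β j t ≤ z}

/-- The distribution function of the highest bid of the rivals of agent `i`. -/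
noncomputable def rivalCdf (i : Fin n) (z : ℝ) : ℝ := ∏ j ∈ Finset.univ.erase i, bidCdf μ β j z

/-- The interim probability that agent `i` wins with the bid `y`. -/
noncomputable def winProb (i : Fin n) (y : ℝ) : ℝ :=
  ∫ w, A.alloc (Function.update (fun j => β j (w j)) i y) i ∂Measure.pi μ

/-- `β i t` is an optimal bid of agent `i` with value `t`. -/
structure IsBestBid (i : Fin n) (t : ℝ) : Prop where
  value_nonneg : 0 ≤ t
  bid_nonneg : 0 ≤ β i t
  le : ∀ y, 0 ≤ y → (t - y) * A.winProb μ β i y ≤ (t - β i t) * A.winProb μ β i (β i t)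

theorem interimUtility_eq (i : Fin n) (vi x : ℝ) :
    A.interimUtility μ β i vi x = (vi - x) * A.winProb μ β i x := by
  rw [interimUtility, winProb, ← integral_const_mul]
  congr 1
  funext w
  simp [utility, payment]
  ring

variable {μ β}

theorem IsBayesNash.ae_isBestBid (hβ : A.IsBayesNash μ β)
    (hnonneg : ∀ i, ∀ᵐ v ∂(μ i), 0 ≤ v) (i : Fin n) : ∀ᵐ t ∂μ i, A.IsBestBid μ β i t := by
  filter_upwards [hnonneg i, hβ.2 i] with t ht h
  exact ⟨ht, h.1, fun y hy => by simpa only [interimUtility_eq] using h.2 y hy⟩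

theorem measurable_bids (hm : ∀ i, Measurable (β i)) :
    Measurable fun w : Fin n → ℝ => fun j => β j (w j) :=
  measurable_pi_lambda _ fun j => (hm j).comp (measurable_pi_apply j)

theorem bidCdf_nonneg (j : Fin n) (z : ℝ) : 0 ≤ bidCdf μ β j z := measureReal_nonneg

theorem winProb_nonneg (i : Fin n) (y : ℝ) : 0 ≤ A.winProb μ β i y :=
  integral_nonneg fun _ => A.alloc_nonneg _ _

theorem rivalCdf_eq_mul {i j : Fin n} (hij : j ≠ i) (z : ℝ) : rivalCdf μ β i z =
    bidCdf μ β j z * ∏ k ∈ (Finset.univ.erase i).erase j, bidCdf μ β k z :=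
  (Finset.mul_prod_erase _ (fun k => bidCdf μ β k z) (by simp [hij])).symm

theorem rivalCdf_nonneg (i : Fin n) (z : ℝ) : 0 ≤ rivalCdf μ β i z :=
  Finset.prod_nonneg fun j _ => bidCdf_nonneg j z

variable {A}

namespace IsBestBid

variable {i : Fin n} {t : ℝ}

theorem utility_nonneg (h : A.IsBestBid μ β i t) :
    0 ≤ (t - β i t) * A.winProb μ β i (β i t) := by
  refine le_trans ?_ (h.le 0 le_rfl)
  rw [sub_zero]
  exact mul_nonneg h.value_nonneg (A.winProb_nonneg _ _)

theorem winProb_pos (hu : 0 < (t - β i t) * A.winProb μ β i (β i t)) :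
    0 < A.winProb μ β i (β i t) := by
  refine lt_of_le_of_ne (A.winProb_nonneg _ _) fun h => ?_
  rw [← h, mul_zero] at hu
  exact hu.false

theorem bid_lt (hu : 0 < (t - β i t) * A.winProb μ β i (β i t)) : β i t < t :=
  sub_pos.1 (pos_of_mul_pos_left hu (winProb_pos hu).le)

end IsBestBid

end FirstPriceAuction

theorem measurableSet_forall_ne {n : ℕ} (i : Fin n) {S : Fin n → Set ℝ}
    (hS : ∀ j, MeasurableSet (S j)) : MeasurableSet {w : Fin n → ℝ | ∀ j, j ≠ i → w j ∈ S j} := by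
  have : {w : Fin n → ℝ | ∀ j, j ≠ i → w j ∈ S j} = ⋂ j, ⋂ (_ : j ≠ i), {w | w j ∈ S j} := by
    ext w
    simp
  rw [this]
  exact MeasurableSet.iInter fun j => MeasurableSet.iInter fun _ => measurable_pi_apply j (hS j)

namespace FirstPriceAuction

variable {n : ℕ} (A : FirstPriceAuction n) {μ : Fin n → Measure ℝ}
  [∀ i, IsProbabilityMeasure (μ i)] {β : Fin n → ℝ → ℝ}

theorem measurable_alloc_update (hm : ∀ i, Measurable (β i)) (i k : Fin n) (y : ℝ) :
    Measurable fun w : Fin n → ℝ => A.alloc (Function.update (fun j => β j (w j)) i y) k :=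
  (A.measurable_alloc k).comp ((measurable_update_prod i).comp
    (measurable_const.prodMk (measurable_bids hm)))

theorem bidCdf_le_one (j : Fin n) (z : ℝ) : bidCdf μ β j z ≤ 1 := measureReal_le_one

theorem bidCdf_mono (j : Fin n) : Monotone (bidCdf μ β j) :=
  fun _ _ h => measureReal_mono fun _ ht => le_trans ht h

theorem rivalCdf_mono (i : Fin n) : Monotone (rivalCdf μ β i) :=
  fun _ _ h => Finset.prod_le_prod (fun j _ => bidCdf_nonneg j _) fun j _ => bidCdf_mono j h

theorem rivalCdf_eq_measureReal (i : Fin n) (z : ℝ) :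
    rivalCdf μ β i z = (Measure.pi μ).real {w | ∀ j, j ≠ i → β j (w j) ≤ z} :=
  (measureReal_pi_forall_ne μ i fun j => {t | β j t ≤ z}).symm

theorem measurableSet_rivals_le (hm : ∀ i, Measurable (β i)) (i : Fin n) (z : ℝ) :
    MeasurableSet {w : Fin n → ℝ | ∀ j, j ≠ i → β j (w j) ≤ z} :=
  measurableSet_forall_ne i fun j => hm j measurableSet_Iic

theorem integrable_alloc_update (hm : ∀ i, Measurable (β i)) (i k : Fin n) (y : ℝ) :
    Integrable (fun w : Fin n → ℝ => A.alloc (Function.update (fun j => β j (w j)) i y) k)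
      (Measure.pi μ) :=
  Integrable.of_bound (A.measurable_alloc_update hm i k y).aestronglyMeasurable 1
    (ae_of_all _ fun w => by
      rw [Real.norm_of_nonneg (A.alloc_nonneg _ _)]
      exact A.alloc_le_one _ _)

theorem alloc_update_le_indicator (i : Fin n) (y : ℝ) (w : Fin n → ℝ) :
    A.alloc (Function.update (fun j => β j (w j)) i y) i ≤
      {w : Fin n → ℝ | ∀ j, j ≠ i → β j (w j) ≤ y}.indicator 1 w := by
  by_cases hw : w ∈ {w : Fin n → ℝ | ∀ j, j ≠ i → β j (w j) ≤ y}
  · rw [Set.indicator_of_mem hw]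
    exact A.alloc_le_one _ _
  · rw [Set.indicator_of_notMem hw]
    by_contra! h
    refine hw fun j hj => ?_
    simpa [Function.update_of_ne hj] using A.highest_of_alloc_pos _ _ h j

theorem winProb_le_rivalCdf (hm : ∀ i, Measurable (β i)) (i : Fin n) (y : ℝ) :
    A.winProb μ β i y ≤ rivalCdf μ β i y := by
  rw [rivalCdf_eq_measureReal, ← integral_indicator_one (measurableSet_rivals_le hm i y)]
  exact integral_mono (A.integrable_alloc_update hm i i y)
    ((integrable_const 1).indicator (measurableSet_rivals_le hm i y))
    fun w => A.alloc_update_le_indicator i y w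

theorem rivalCdf_le_winProb (hm : ∀ i, Measurable (β i)) (i : Fin n) {z y : ℝ} (h : z < y) :
    rivalCdf μ β i z ≤ A.winProb μ β i y := by
  rw [rivalCdf_eq_measureReal, ← integral_indicator_one (measurableSet_rivals_le hm i z)]
  refine integral_mono ((integrable_const 1).indicator (measurableSet_rivals_le hm i z))
    (A.integrable_alloc_update hm i i y) fun w => ?_
  by_cases hw : w ∈ {w : Fin n → ℝ | ∀ j, j ≠ i → β j (w j) ≤ z}
  · simp only [Set.indicator_of_mem hw]
    rw [A.alloc_eq_one]
    · simp
    · intro j hj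
      simpa [Function.update_of_ne hj] using (hw j hj).trans_lt h
  · simp only [Set.indicator_of_notMem hw]
    exact A.alloc_nonneg _ _

variable {A}

namespace IsBestBid

variable {i j : Fin n} {s t v : ℝ}

/-- Bidding slightly above `y` beats every rival bid up to `y`, so a deviation is worth as much as
if all ties at `y` were won. -/
theorem sub_mul_rivalCdf_le (hm : ∀ i, Measurable (β i)) (h : A.IsBestBid μ β i t) {y : ℝ}
    (hy : 0 ≤ y) : (t - y) * rivalCdf μ β i y ≤ (t - β i t) * A.winProb μ β i (β i t) := by
  rcases le_or_gt t y with hty | hyt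
  · exact (mul_nonpos_of_nonpos_of_nonneg (by linarith) (rivalCdf_nonneg i y)).trans
      h.utility_nonneg
  · have htend : Filter.Tendsto (fun y' => (t - y') * rivalCdf μ β i y) (nhdsWithin y (Set.Ioi y))
        (nhds ((t - y) * rivalCdf μ β i y)) :=
      ((by fun_prop : Continuous fun y' => (t - y') * rivalCdf μ β i y).tendsto y).mono_left
        nhdsWithin_le_nhds
    refine le_of_tendsto htend ?_
    filter_upwards [Ioo_mem_nhdsGT hyt] with y' hy'
    exact (mul_le_mul_of_nonneg_left (A.rivalCdf_le_winProb hm i hy'.1)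
      (by linarith [hy'.2])).trans (h.le y' (hy.trans hy'.1.le))

/-- With positive utility, losing ties with positive probability would make a tiny overbid
profitable; hence the tie-breaking rule plays no role. -/
theorem rivalCdf_eq_winProb (hm : ∀ i, Measurable (β i)) (h : A.IsBestBid μ β i t)
    (hu : 0 < (t - β i t) * A.winProb μ β i (β i t)) :
    rivalCdf μ β i (β i t) = A.winProb μ β i (β i t) :=
  le_antisymm (le_of_mul_le_mul_left (h.sub_mul_rivalCdf_le hm h.bid_nonneg)
    (sub_pos.2 (bid_lt hu))) (A.winProb_le_rivalCdf hm _ _)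

/-- Adding the two incentive constraints shows that the larger value wins at least as often. If the
smaller value bid more, the win probabilities would then coincide and it would be paying more for
the same chance. -/
theorem bid_mono (hm : ∀ i, Measurable (β i)) (hs : A.IsBestBid μ β i s)
    (ht : A.IsBestBid μ β i t) (hst : s < t)
    (hu : 0 < (t - β i t) * A.winProb μ β i (β i t)) : β i s ≤ β i t := by
  by_contra! hlt
  have hX := winProb_pos hu
  have h1 := hs.le _ ht.bid_nonneg
  have h2 := ht.le _ hs.bid_nonneg
  have h3 : A.winProb μ β i (β i t) ≤ A.winProb μ β i (β i s) :=
    (A.winProb_le_rivalCdf hm _ _).trans (A.rivalCdf_le_winProb hm _ hlt)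
  have h4 : A.winProb μ β i (β i s) ≤ A.winProb μ β i (β i t) :=
    le_of_mul_le_mul_left (by linarith : (t - s) * _ ≤ (t - s) * _) (sub_pos.2 hst)
  rw [le_antisymm h4 h3] at h1
  linarith [le_of_mul_le_mul_right h1 hX]

theorem measureReal_Iic_le_bidCdf (hm : ∀ i, Measurable (β i))
    (hgood : ∀ᵐ t ∂μ i, A.IsBestBid μ β i t) (hv : A.IsBestBid μ β i v)
    (hu : 0 < (v - β i v) * A.winProb μ β i (β i v)) :
    (μ i).real (Set.Iic v) ≤ bidCdf μ β i (β i v) := by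
  refine ENNReal.toReal_mono (measure_ne_top _ _) (measure_mono_ae ?_)
  filter_upwards [hgood] with s hs hsv
  rcases (show s ≤ v from hsv).eq_or_lt with rfl | hlt
  · exact le_rfl
  · exact hs.bid_mono hm hv hlt hu

/-- A rival that overbids agent `i` has a value that is not much smaller. -/
theorem rivalCdf_mul_sub_le (hm : ∀ i, Measurable (β i)) (hij : j ≠ i) {q : ℝ}
    (hv : A.IsBestBid μ β i v) (hu : 0 < (v - β i v) * A.winProb μ β i (β i v))
    (ht : A.IsBestBid μ β j t) (hq0 : 0 < q) (hq1 : q ≤ 1) (hq : q ≤ bidCdf μ β i (β i v))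
    (hz : β i v < β j t) :
    rivalCdf μ β i (β j t) * (v - t) ≤ rivalCdf μ β i (β i v) * (v - q * t) := by
  have hb0 := hv.bid_nonneg
  have hFib : 0 < rivalCdf μ β i (β i v) := by
    rw [hv.rivalCdf_eq_winProb hm hu]
    exact winProb_pos hu
  have h2 : (v - β j t) * rivalCdf μ β i (β j t) ≤ (v - β i v) * rivalCdf μ β i (β i v) := by
    rw [hv.rivalCdf_eq_winProb hm hu]
    exact hv.sub_mul_rivalCdf_le hm ht.bid_nonneg
  have h1 := ht.sub_mul_rivalCdf_le hm hb0
  have hXle := A.winProb_le_rivalCdf (μ := μ) hm j (β j t)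
  have hXge := A.rivalCdf_le_winProb (μ := μ) hm j hz
  have hun := ht.utility_nonneg
  set b := β i v
  set z := β j t
  have hiz := rivalCdf_eq_mul (μ := μ) (β := β) hij z
  have hib := rivalCdf_eq_mul (μ := μ) (β := β) hij b
  have hjz := rivalCdf_eq_mul (μ := μ) (β := β) hij.symm z
  have hjb := rivalCdf_eq_mul (μ := μ) (β := β) hij.symm b
  rw [Finset.erase_right_comm] at hjz hjb
  set Eb := ∏ k ∈ (Finset.univ.erase i).erase j, bidCdf μ β k b
  set Ez := ∏ k ∈ (Finset.univ.erase i).erase j, bidCdf μ β k z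
  have hEb : 0 < Eb := by
    refine lt_of_le_of_ne (Finset.prod_nonneg fun k _ => bidCdf_nonneg k b) fun h => ?_
    rw [hib, ← h, mul_zero] at hFib
    exact hFib.false
  have hEz : 0 ≤ Ez := Finset.prod_nonneg fun k _ => bidCdf_nonneg k z
  have hFjb : 0 < rivalCdf μ β j b := by
    rw [hjb]
    exact mul_pos (hq0.trans_le hq) hEb
  have hX : 0 < A.winProb μ β j z := hFjb.trans_le hXge
  have htz : 0 ≤ t - z := nonneg_of_mul_nonneg_left hun hX
  have hFjz : 0 < rivalCdf μ β j z := hX.trans_le hXle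
  -- After cancelling the factors of the other agents, only the bids of `i` and `j` remain: `i` bids
  -- at most `b` with probability at least `q`, and the distribution function of `j` is monotone.
  have hcross : q * rivalCdf μ β i b * rivalCdf μ β j z ≤
      rivalCdf μ β j b * rivalCdf μ β i z := by
    rw [hib, hiz, hjb, hjz]
    have e1 : q * bidCdf μ β i z ≤ bidCdf μ β i b :=
      (mul_le_of_le_one_right hq0.le (bidCdf_le_one i z)).trans hq
    have e2 : bidCdf μ β j b ≤ bidCdf μ β j z := bidCdf_mono j hz.le
    calc q * (bidCdf μ β j b * Eb) * (bidCdf μ β i z * Ez)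
        = (q * bidCdf μ β i z) * bidCdf μ β j b * (Eb * Ez) := by ring
      _ ≤ bidCdf μ β i b * bidCdf μ β j z * (Eb * Ez) :=
        mul_le_mul_of_nonneg_right (mul_le_mul e1 e2 (bidCdf_nonneg _ _) (bidCdf_nonneg _ _))
          (mul_nonneg hEb.le hEz)
      _ = _ := by ring
  have h3 : (t - b) * rivalCdf μ β j b ≤ (t - z) * rivalCdf μ β j z :=
    h1.trans (mul_le_mul_of_nonneg_left hXle htz)
  have h4 : (t - b) * (q * rivalCdf μ β i b) ≤ (t - z) * rivalCdf μ β i z := by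
    refine le_of_mul_le_mul_right ?_ hFjz
    have e1 := mul_le_mul_of_nonneg_left hcross (by linarith : 0 ≤ t - b)
    have e2 := mul_le_mul_of_nonneg_right h3 (rivalCdf_nonneg (μ := μ) (β := β) i z)
    linarith
  -- Subtracting `h4` from `h2` eliminates `z`; the leftover term in `b` has a favourable sign and
  -- is dropped.
  have h5 : 0 ≤ rivalCdf μ β i b * (b * (1 - q)) :=
    mul_nonneg hFib.le (mul_nonneg hb0 (by linarith))
  linarith

/-- Conditioning on values below `v` makes the bids of a rival smaller, in the monotone likelihood
sense. -/
theorem bidCdf_mul_le (hm : ∀ i, Measurable (β i)) (hij : j ≠ i)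
    (hgood : ∀ᵐ t ∂μ j, A.IsBestBid μ β j t) (hv : A.IsBestBid μ β i v)
    (hu : 0 < (v - β i v) * A.winProb μ β i (β i v)) (hi : 0 < bidCdf μ β i (β i v))
    (hj : 0 < (μ j).real (Set.Iio v)) :
    0 < (μ j).real {t | t < v ∧ β j t ≤ β i v} ∧ ∀ z, β i v ≤ z →
      bidCdf μ β j (β i v) * (μ j).real {t | t < v ∧ β j t ≤ z} ≤
        bidCdf μ β j z * (μ j).real {t | t < v ∧ β j t ≤ β i v} := by
  have hFib : 0 < rivalCdf μ β i (β i v) := by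
    rw [hv.rivalCdf_eq_winProb hm hu]
    exact winProb_pos hu
  rw [rivalCdf_eq_mul hij] at hFib
  have hEb : 0 ≤ ∏ k ∈ (Finset.univ.erase i).erase j, bidCdf μ β k (β i v) :=
    Finset.prod_nonneg fun k _ => bidCdf_nonneg k _
  -- Either almost all values from `v` upwards bid above `β i v`, and conditioning does not change
  -- the event of bidding at most `β i v`; or some such value bids at most `β i v`, and then by
  -- monotonicity all smaller values do too.
  by_cases h : ∀ᵐ t ∂μ j, v ≤ t → β i v < β j t
  · have e : (μ j).real {t | t < v ∧ β j t ≤ β i v} = bidCdf μ β j (β i v) := by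
      refine measureReal_congr ?_
      filter_upwards [h] with t ht
      refine propext ⟨fun h' => h'.2, fun h' => ⟨?_, h'⟩⟩
      by_contra! hvt
      exact absurd (ht hvt) (not_lt.2 h')
    rw [e]
    refine ⟨pos_of_mul_pos_left hFib hEb, fun z _ => ?_⟩
    rw [mul_comm]
    exact mul_le_mul_of_nonneg_right (measureReal_mono fun t ht => ht.2) (bidCdf_nonneg _ _)
  · obtain ⟨t, ht, hgt⟩ := (Filter.not_eventually.1 h).and_eventually hgood |>.exists
    push Not at ht
    have hFj : 0 < rivalCdf μ β j (β i v) := by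
      rw [rivalCdf_eq_mul hij.symm, Finset.erase_right_comm]
      exact mul_pos hi (pos_of_mul_pos_right hFib (bidCdf_nonneg _ _))
    have hut : 0 < (t - β j t) * A.winProb μ β j (β j t) :=
      (mul_pos (by linarith [bid_lt hu]) hFj).trans_le (hgt.sub_mul_rivalCdf_le hm hv.bid_nonneg)
    have e : (μ j).real {t | t < v ∧ β j t ≤ β i v} = (μ j).real (Set.Iio v) := by
      refine measureReal_congr ?_
      filter_upwards [hgood] with s hs
      refine propext ⟨fun h' => h'.1, fun h' => ⟨h', ?_⟩⟩
      exact (hs.bid_mono hm hgt (lt_of_lt_of_le h' ht.1) hut).trans ht.2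
    rw [e]
    refine ⟨hj, fun z hz => ?_⟩
    exact mul_le_mul (bidCdf_mono j hz) (measureReal_mono fun t ht => ht.1) measureReal_nonneg
      (bidCdf_nonneg _ _)

end IsBestBid

end FirstPriceAuction

/-! ### Welfare given that one agent has the highest value. -/

namespace FirstPriceAuction

variable {n : ℕ} {A : FirstPriceAuction n} {μ : Fin n → Measure ℝ}
  [∀ i, IsProbabilityMeasure (μ i)] {β : Fin n → ℝ → ℝ}

theorem bids_update (i : Fin n) (v : ℝ) (w : Fin n → ℝ) :
    (fun j => β j (Function.update w i v j)) = Function.update (fun j => β j (w j)) i (β i v) := by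
  funext j
  by_cases h : j = i
  · subst h
    simp
  · simp [Function.update_of_ne h]

/-- Almost surely, a winner does not bid above the own value. -/
theorem ae_bid_le_of_alloc_pos (hm : ∀ i, Measurable (β i))
    (hgood : ∀ i, ∀ᵐ t ∂μ i, A.IsBestBid μ β i t) :
    ∀ᵐ w ∂Measure.pi μ, ∀ k, 0 < A.alloc (fun j => β j (w j)) k → β k (w k) ≤ w k := by
  refine ae_all_iff.2 fun k => ae_of_ae_ae_update μ k ?_ ?_
  · have : {w : Fin n → ℝ | 0 < A.alloc (fun j => β j (w j)) k → β k (w k) ≤ w k} =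
        {w | 0 < A.alloc (fun j => β j (w j)) k}ᶜ ∪ {w | β k (w k) ≤ w k} := by
      ext w
      simp only [Set.mem_union, Set.mem_compl_iff, Set.mem_ofPred_eq, imp_iff_not_or]
    rw [this]
    exact (measurableSet_lt measurable_const
      ((A.measurable_alloc k).comp (measurable_bids hm))).compl.union
      (measurableSet_le ((hm k).comp (measurable_pi_apply k)) (measurable_pi_apply k))
  · filter_upwards [hgood k] with t ht
    by_cases hle : β k t ≤ t
    · exact ae_of_all _ fun w _ => by simpa using hle
    -- A bid above the value has nonnegative utility only if it never wins.
    · have hX : A.winProb μ β k (β k t) = 0 := by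
        have h1 := ht.utility_nonneg
        have h2 := A.winProb_nonneg (μ := μ) (β := β) k (β k t)
        nlinarith
      rw [winProb, integral_eq_zero_iff_of_nonneg (fun w => A.alloc_nonneg _ _)
        (A.integrable_alloc_update hm k k _)] at hX
      filter_upwards [hX] with w hw hpos
      rw [bids_update, hw] at hpos
      exact absurd hpos (lt_irrefl _)

namespace IsBestBid

variable {i : Fin n} {v : ℝ}

theorem ae_alloc_eq_one (hm : ∀ i, Measurable (β i)) (hv : A.IsBestBid μ β i v)
    (hu : 0 < (v - β i v) * A.winProb μ β i (β i v)) :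
    ∀ᵐ w ∂Measure.pi μ, (∀ j, j ≠ i → β j (w j) ≤ β i v) →
      A.alloc (fun j => β j (Function.update w i v j)) i = 1 := by
  have hms := measurableSet_rivals_le hm i (β i v)
  have hint := A.integrable_alloc_update (μ := μ) hm i i (β i v)
  have hint' : Integrable ({w : Fin n → ℝ | ∀ j, j ≠ i → β j (w j) ≤ β i v}.indicator
    (1 : (Fin n → ℝ) → ℝ)) (Measure.pi μ) := (integrable_const 1).indicator hms
  have h : ∫ w, ({w : Fin n → ℝ | ∀ j, j ≠ i → β j (w j) ≤ β i v}.indicator 1 w -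
      A.alloc (Function.update (fun j => β j (w j)) i (β i v)) i) ∂Measure.pi μ = 0 := by
    rw [integral_sub hint' hint, integral_indicator_one hms, ← rivalCdf_eq_measureReal,
      hv.rivalCdf_eq_winProb hm hu, winProb, sub_self]
  rw [integral_eq_zero_iff_of_nonneg
    (fun w => sub_nonneg.2 (A.alloc_update_le_indicator i _ w)) (hint'.sub hint)] at h
  filter_upwards [h] with w hw hle
  rw [bids_update]
  simp only [Pi.zero_apply] at hw
  rw [Set.indicator_of_mem (show w ∈ {w : Fin n → ℝ | ∀ j, j ≠ i → β j (w j) ≤ β i v} from hle),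
    Pi.one_apply] at hw
  linarith

/-- If all rival bids stayed below `v` with positive probability, some bid below `v` would win with
positive probability and earn a positive utility. -/
theorem ae_exists_le_bid_of_utility_nonpos (hm : ∀ i, Measurable (β i))
    (hv : A.IsBestBid μ β i v) (hv0 : 0 < v)
    (hu : (v - β i v) * A.winProb μ β i (β i v) ≤ 0) :
    ∀ᵐ w ∂Measure.pi μ, ∃ j, j ≠ i ∧ v ≤ β j (w j) := by
  obtain ⟨y, -, hy, hlim⟩ := exists_seq_strictMono_tendsto' hv0
  have h0 : ∀ k, ∀ᵐ w ∂Measure.pi μ, ¬ ∀ j, j ≠ i → β j (w j) ≤ y k := by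
    intro k
    have h1 := (hv.sub_mul_rivalCdf_le hm (hy k).1.le).trans hu
    have h2 : rivalCdf μ β i (y k) = 0 :=
      le_antisymm (nonpos_of_mul_nonpos_right h1 (sub_pos.2 (hy k).2)) (rivalCdf_nonneg _ _)
    rw [rivalCdf_eq_measureReal, measureReal_eq_zero_iff] at h2
    rw [ae_iff]
    simpa using h2
  filter_upwards [ae_all_iff.2 h0] with w hw
  by_contra! hlt
  have hev : ∀ᶠ k in Filter.atTop, ∀ j, j ≠ i → β j (w j) ≤ y k := by
    refine Filter.eventually_all.2 fun j => ?_
    by_cases hj : j = i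
    · simp [hj]
    · filter_upwards [hlim.eventually_const_lt (hlt j hj)] with k hk _ using hk.le
  obtain ⟨k, hk⟩ := hev.exists
  exact hw k hk

/-- A rival bids at least `v`, so the winner does too, and winners do not bid above their values. -/
theorem ae_ofReal_le_of_utility_nonpos (hm : ∀ i, Measurable (β i))
    (hv : A.IsBestBid μ β i v)
    (hover : ∀ᵐ w ∂Measure.pi μ, ∀ k, 0 < A.alloc (fun j => β j (Function.update w i v j)) k →
      β k (Function.update w i v k) ≤ Function.update w i v k)
    (hu : (v - β i v) * A.winProb μ β i (β i v) ≤ 0) :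
    ∀ᵐ w ∂Measure.pi μ, ENNReal.ofReal v ≤ ∑ k, ENNReal.ofReal (Function.update w i v k *
      A.alloc (fun j => β j (Function.update w i v j)) k) := by
  rcases hv.value_nonneg.eq_or_lt with h0 | hv0
  · simp [← h0]
  filter_upwards [hover, hv.ae_exists_le_bid_of_utility_nonpos hm hv0 hu] with w hw hex
  obtain ⟨j, hj, hvj⟩ := hex
  refine A.ofReal_le_sum_mul_alloc fun k hk => ?_
  have h1 := A.highest_of_alloc_pos _ _ hk j
  have h2 := hw k hk
  rw [Function.update_of_ne hj] at h1
  linarith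

theorem ofReal_mul_measure_le_setLIntegral_of_pos (hm : ∀ i, Measurable (β i))
    (hgood : ∀ k, ∀ᵐ t ∂μ k, A.IsBestBid μ β k t) (hv : A.IsBestBid μ β i v)
    (hu : 0 < (v - β i v) * A.winProb μ β i (β i v))
    (h0 : 0 < (μ i).real (Set.Iic v)) (h1 : (μ i).real (Set.Iic v) < 1) :
    ENNReal.ofReal (v * leastFraction (∏ k, (μ k).real (Set.Iic v))) *
        Measure.pi μ {w | ∀ j, j ≠ i → w j < v} ≤
      ∫⁻ w in {w | ∀ j, j ≠ i → w j < v}, ∑ k, ENNReal.ofReal (Function.update w i v k *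
        A.alloc (fun j => β j (Function.update w i v j)) k) ∂Measure.pi μ := by
  set H : Set (Fin n → ℝ) := {w | ∀ j, j ≠ i → w j < v} with hH
  have hHm : MeasurableSet H := measurableSet_forall_ne i fun j => measurableSet_Iio
  rcases eq_or_ne (Measure.pi μ H) 0 with hH0 | hH0
  · simp [hH0]
  set b := β i v with hb
  set q := ∏ k, (μ k).real (Set.Iic v) with hq
  set K : ℝ → ℝ := fun z => ∏ j ∈ Finset.univ.erase i, (μ j).real {t | t < v ∧ β j t ≤ z} with hK
  have hpHeq : (Measure.pi μ).real H = ∏ j ∈ Finset.univ.erase i, (μ j).real (Set.Iio v) :=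
    measureReal_pi_forall_ne μ i fun _ => Set.Iio v
  have hpH : 0 < (Measure.pi μ).real H := ENNReal.toReal_pos hH0 (measure_ne_top _ _)
  have hIio : ∀ j, j ≠ i → 0 < (μ j).real (Set.Iio v) := by
    intro j hj
    refine lt_of_le_of_ne measureReal_nonneg fun h => ?_
    rw [hpHeq, Finset.prod_eq_zero (Finset.mem_erase.2 ⟨hj, Finset.mem_univ j⟩) h.symm] at hpH
    exact hpH.false
  have hq0 : 0 < q := Finset.prod_pos fun k _ => by
    by_cases hk : k = i
    · rw [hk]
      exact h0
    · exact (hIio k hk).trans_le (measureReal_mono Set.Iio_subset_Iic_self)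
  have hqi : q ≤ (μ i).real (Set.Iic v) := by
    rw [hq, ← Finset.mul_prod_erase _ _ (Finset.mem_univ i)]
    exact mul_le_of_le_one_right measureReal_nonneg
      (Finset.prod_le_one (fun _ _ => measureReal_nonneg) fun _ _ => measureReal_le_one)
  have hq1 : q < 1 := hqi.trans_lt h1
  have hqI : q ∈ Set.Icc (0 : ℝ) 1 := ⟨hq0.le, hq1.le⟩
  have hqb : q ≤ bidCdf μ β i b := hqi.trans (measureReal_Iic_le_bidCdf hm (hgood i) hv hu)
  have hratio := fun j (hj : j ≠ i) =>
    bidCdf_mul_le hm hj (hgood j) hv hu (hq0.trans_le hqb) (hIio j hj)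
  have hKb : 0 < K b := Finset.prod_pos fun j hj => (hratio j (Finset.ne_of_mem_erase hj)).1
  -- The likelihood-ratio comparison is multiplied over the independent rivals; it transfers the
  -- bound from the unconditional law of their bids to the one given that their values are below
  -- `v`.
  have hFK : ∀ z, b ≤ z → rivalCdf μ β i b * K z ≤ rivalCdf μ β i z * K b := by
    intro z hz
    simp only [rivalCdf, hK, ← Finset.prod_mul_distrib]
    exact Finset.prod_le_prod
      (fun j _ => mul_nonneg (bidCdf_nonneg j b) measureReal_nonneg)
      fun j hj => (hratio j (Finset.ne_of_mem_erase hj)).2 z hz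
  have hFb : 0 < rivalCdf μ β i b := by
    rw [hb, hv.rivalCdf_eq_winProb hm hu]
    exact winProb_pos hu
  -- the law of the highest bid, given that agent `i` has the highest value
  set M : (Fin n → ℝ) → ℝ := fun w => ⨆ j, β j (Function.update w i v j) with hM
  have hMm : Measurable M := Measurable.iSup fun j =>
    (hm j).comp ((measurable_pi_apply j).comp ((measurable_update_prod i).comp
      (measurable_const.prodMk measurable_id)))
  have hMle : ∀ w z, M w ≤ z ↔ b ≤ z ∧ ∀ j, j ≠ i → β j (w j) ≤ z := by
    intro w z
    have : Nonempty (Fin n) := ⟨i⟩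
    rw [hM, ciSup_le_iff (Set.finite_range _).bddAbove]
    constructor
    · intro h
      exact ⟨by simpa using h i, fun j hj => by simpa [Function.update_of_ne hj] using h j⟩
    · rintro ⟨hbz, h⟩ j
      by_cases hj : j = i
      · subst hj
        simpa using hbz
      · simpa [Function.update_of_ne hj] using h j hj
  set P := ProbabilityTheory.cond (Measure.pi μ) H with hP
  have hPprob : IsProbabilityMeasure P := ProbabilityTheory.cond_isProbabilityMeasure hH0
  set ν := P.map M with hν
  have hνprob : IsProbabilityMeasure ν := Measure.isProbabilityMeasure_map hMm.aemeasurable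
  have hνK : ∀ z, b ≤ z → ν.real (Set.Iic z) = K z / (Measure.pi μ).real H := by
    intro z hz
    have hset : H ∩ M ⁻¹' Set.Iic z = {w | ∀ j, j ≠ i → w j ∈ {t | t < v ∧ β j t ≤ z}} := by
      ext w
      simp only [Set.mem_inter_iff, Set.mem_preimage, Set.mem_Iic, hMle, hz, true_and, hH,
        Set.mem_ofPred_eq]
      exact ⟨fun h j hj => ⟨h.1 j hj, h.2 j hj⟩,
        fun h => ⟨fun j hj => (h j hj).1, fun j hj => (h j hj).2⟩⟩
    rw [measureReal_def, hν, Measure.map_apply hMm measurableSet_Iic, hP,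
      ProbabilityTheory.cond_apply hHm, hset, ENNReal.toReal_mul, ENNReal.toReal_inv,
      ← measureReal_def, ← measureReal_def, measureReal_pi_forall_ne, div_eq_inv_mul]
  have hx : 0 < ν.real (Set.Iic b) := by
    rw [hνK b le_rfl]
    positivity
  have hmain := ofReal_welfareFraction_le_lintegral ν hqI hq1 hx
  have hleast := leastFraction_le hqI ⟨hx.le, measureReal_le_one⟩
  set x := ν.real (Set.Iic b) with hxdef
  -- `Λ z` bounds the fraction of `v` lost when the highest bid is `z`; nothing is lost when agent
  -- `i` wins.
  set Λ : ℝ → ℝ := fun z => if z ≤ b then 0 else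
    (1 - q) * x / (ν.real (Set.Iic z) - q * x) with hΛ
  have hΛm : Measurable Λ := by
    have := (monotone_measureReal_Iic ν).measurable
    exact Measurable.ite measurableSet_Iic measurable_const (by fun_prop)
  have hpt : ∀ᵐ w ∂(Measure.pi μ).restrict H, ENNReal.ofReal (v * (1 - Λ (M w))) ≤
      ∑ k, ENNReal.ofReal (Function.update w i v k *
        A.alloc (fun j => β j (Function.update w i v j)) k) := by
    filter_upwards [ae_restrict_mem hHm, ae_restrict_of_ae (ae_pi_forall μ hgood),
      ae_restrict_of_ae (hv.ae_alloc_eq_one hm hu)] with w hwH hwg hwa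
    by_cases hMb : M w ≤ b
    · have ha := hwa ((hMle w b).1 hMb).2
      refine le_trans (le_of_eq ?_) (Finset.single_le_sum (fun _ _ => zero_le)
        (Finset.mem_univ i))
      rw [ha]
      simp [hΛ, hMb]
    · refine A.ofReal_le_sum_mul_alloc fun k hk => ?_
      have hkM : β k (Function.update w i v k) = M w := by
        have : Nonempty (Fin n) := ⟨i⟩
        exact le_antisymm (le_ciSup (f := fun j => β j (Function.update w i v j))
          (Set.finite_range _).bddAbove k) (ciSup_le (A.highest_of_alloc_pos _ k hk))
      have hki : k ≠ i := by
        rintro rfl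
        rw [Function.update_self] at hkM
        exact hMb hkM.ge
      rw [Function.update_of_ne hki] at hkM ⊢
      have hlt : b < M w := not_le.1 hMb
      have htv : w k < v := hwH k hki
      have hval := rivalCdf_mul_sub_le hm hki hv hu (hwg k) hq0 hq1.le hqb (hkM ▸ hlt)
      rw [hkM] at hval
      have hFz : 0 < rivalCdf μ β i (M w) := hFb.trans_le (rivalCdf_mono i hlt.le)
      have hKz : 0 ≤ K (M w) := Finset.prod_nonneg fun _ _ => measureReal_nonneg
      have hvt : 0 ≤ v - q * w k := by nlinarith [(hwg k).value_nonneg]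
      -- The equilibrium inequality and the likelihood-ratio comparison are multiplied, and the
      -- unconditional `rivalCdf` at the top bid cancels.
      have hK' : K (M w) * (v - w k) ≤ K b * (v - q * w k) := by
        refine le_of_mul_le_mul_left ?_ hFz
        have e1 := mul_le_mul_of_nonneg_left hval hKz
        have e2 := mul_le_mul_of_nonneg_right (hFK (M w) hlt.le) hvt
        linarith
      have hF : ν.real (Set.Iic (M w)) * (v - w k) ≤ x * (v - q * w k) := by
        rw [hxdef, hνK _ hlt.le, hνK b le_rfl, div_mul_eq_mul_div, div_mul_eq_mul_div]
        gcongr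
      have hxF : x ≤ ν.real (Set.Iic (M w)) := monotone_measureReal_Iic ν hlt.le
      have hden : 0 < ν.real (Set.Iic (M w)) - q * x := by nlinarith
      have e : 1 - Λ (M w) = (ν.real (Set.Iic (M w)) - x) / (ν.real (Set.Iic (M w)) - q * x) := by
        simp only [hΛ, if_neg hMb]
        field_simp
        ring
      rw [e, mul_div_assoc', div_le_iff₀ hden]
      linarith
  calc ENNReal.ofReal (v * leastFraction q) * Measure.pi μ H
      ≤ ENNReal.ofReal v * (∫⁻ z, ENNReal.ofReal (1 - Λ z) ∂ν) * Measure.pi μ H := by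
        rw [ENNReal.ofReal_mul hv.value_nonneg]
        gcongr
        exact (ENNReal.ofReal_le_ofReal hleast).trans hmain
    _ = ∫⁻ w in H, ENNReal.ofReal (v * (1 - Λ (M w))) ∂Measure.pi μ := by
        rw [hν, lintegral_map (by fun_prop) hMm, hP, ProbabilityTheory.cond,
          lintegral_smul_measure, smul_eq_mul, mul_comm, ← mul_assoc, mul_comm _ (ENNReal.ofReal v),
          mul_assoc, ← mul_assoc (Measure.pi μ H), ENNReal.mul_inv_cancel hH0 (measure_ne_top _ _),
          one_mul, ← lintegral_const_mul _ (by fun_prop)]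
        simp_rw [ENNReal.ofReal_mul hv.value_nonneg]
    _ ≤ _ := lintegral_mono_ae hpt

theorem ofReal_mul_measure_le_setLIntegral (hm : ∀ i, Measurable (β i))
    (hgood : ∀ k, ∀ᵐ t ∂μ k, A.IsBestBid μ β k t) (hv : A.IsBestBid μ β i v)
    (hover : ∀ᵐ w ∂Measure.pi μ, ∀ k, 0 < A.alloc (fun j => β j (Function.update w i v j)) k →
      β k (Function.update w i v k) ≤ Function.update w i v k)
    (h0 : 0 < (μ i).real (Set.Iic v)) (h1 : (μ i).real (Set.Iic v) < 1) :
    ENNReal.ofReal (v * leastFraction (∏ k, (μ k).real (Set.Iic v))) *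
        Measure.pi μ {w | ∀ j, j ≠ i → w j < v} ≤
      ∫⁻ w in {w | ∀ j, j ≠ i → w j < v}, ∑ k, ENNReal.ofReal (Function.update w i v k *
        A.alloc (fun j => β j (Function.update w i v j)) k) ∂Measure.pi μ := by
  rcases lt_or_ge 0 ((v - β i v) * A.winProb μ β i (β i v)) with hu | hu
  · exact hv.ofReal_mul_measure_le_setLIntegral_of_pos hm hgood hu h0 h1
  · have hle : v * leastFraction (∏ k, (μ k).real (Set.Iic v)) ≤ v :=
      mul_le_of_le_one_right hv.value_nonneg (leastFraction_le_one
        ⟨Finset.prod_nonneg fun _ _ => measureReal_nonneg,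
          Finset.prod_le_one (fun _ _ => measureReal_nonneg) fun _ _ => measureReal_le_one⟩)
    rw [← setLIntegral_const]
    refine lintegral_mono_ae (ae_restrict_of_ae ?_)
    filter_upwards [hv.ae_ofReal_le_of_utility_nonpos hm hover hu] with w hw
    exact (ENNReal.ofReal_le_ofReal hle).trans hw

end IsBestBid

end FirstPriceAuction

/-! ### The highest value and the agent who has it. -/

section MaxValue

variable {n : ℕ} (μ : Fin n → Measure ℝ)

theorem measurable_iSup_eval : Measurable fun w : Fin n → ℝ => ⨆ i, w i :=
  Measurable.iSup fun i => measurable_pi_apply i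

theorem optimalWelfare_eq [Nonempty (Fin n)] :
    optimalWelfare μ = ∫⁻ z, ENNReal.ofReal z ∂(Measure.pi μ).map fun w => ⨆ i, w i := by
  rw [lintegral_map (by fun_prop) measurable_iSup_eval, optimalWelfare]
  refine lintegral_congr fun w => le_antisymm ?_ ?_
  · exact iSup_le fun i => ENNReal.ofReal_le_ofReal (le_ciSup (Set.finite_range w).bddAbove i)
  · obtain ⟨i, hi⟩ := exists_eq_ciSup_of_finite (f := w)
    rw [← hi]
    exact le_iSup (fun i => ENNReal.ofReal (w i)) i

variable [∀ i, IsProbabilityMeasure (μ i)]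

theorem measureReal_map_iSup_Iic [Nonempty (Fin n)] (z : ℝ) :
    ((Measure.pi μ).map fun w => ⨆ i, w i).real (Set.Iic z) = ∏ k, (μ k).real (Set.Iic z) := by
  have : (fun w : Fin n → ℝ => ⨆ i, w i) ⁻¹' Set.Iic z = Set.univ.pi fun _ => Set.Iic z := by
    ext w
    simp [ciSup_le_iff (Set.finite_range w).bddAbove, Pi.le_def]
  rw [measureReal_def, Measure.map_apply measurable_iSup_eval measurableSet_Iic, this,
    Measure.pi_pi, ENNReal.toReal_prod]
  rfl

/-- The event that agent `i` has the strictly highest value. -/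
def topSet (i : Fin n) : Set (Fin n → ℝ) := {w | ∀ j, j ≠ i → w j < w i}

theorem measurableSet_topSet (i : Fin n) : MeasurableSet (topSet i) := by
  have : topSet i = ⋂ j, ⋂ (_ : j ≠ i), {w : Fin n → ℝ | w j < w i} := by
    ext w
    simp [topSet]
  rw [this]
  exact MeasurableSet.iInter fun j => MeasurableSet.iInter fun _ =>
    measurableSet_lt (measurable_pi_apply j) (measurable_pi_apply i)

theorem pairwise_disjoint_topSet : Pairwise (Function.onFun Disjoint (topSet (n := n))) := by
  intro i j hij
  refine Set.disjoint_left.2 fun w hi hj => ?_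
  exact lt_asymm (hi j hij.symm) (hj i hij)

theorem iSup_eq_of_mem_topSet {i : Fin n} {w : Fin n → ℝ} (h : w ∈ topSet i) :
    ⨆ j, w j = w i := by
  have : Nonempty (Fin n) := ⟨i⟩
  refine le_antisymm (ciSup_le fun j => ?_) (le_ciSup (Set.finite_range w).bddAbove i)
  rcases eq_or_ne j i with rfl | hj
  · exact le_rfl
  · exact (h j hj).le

theorem restrict_iUnion_topSet [Nonempty (Fin n)] [∀ i, NullSingletonClass (μ i)] :
    (Measure.pi μ).restrict (⋃ i, topSet i) = Measure.pi μ := by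
  refine Measure.restrict_eq_self_of_ae_mem ?_
  filter_upwards [ae_pi_ne μ] with w hw
  obtain ⟨i, hi⟩ := exists_eq_ciSup_of_finite (f := w)
  refine Set.mem_iUnion.2 ⟨i, fun j hj => lt_of_le_of_ne ?_ (hw i j hj)⟩
  rw [hi]
  exact le_ciSup (Set.finite_range w).bddAbove j

theorem lintegral_pi_eq_sum_topSet [Nonempty (Fin n)] [∀ i, NullSingletonClass (μ i)]
    (f : (Fin n → ℝ) → ENNReal) :
    ∫⁻ w, f w ∂Measure.pi μ = ∑ i, ∫⁻ w in topSet i, f w ∂Measure.pi μ := by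
  conv_lhs => rw [← restrict_iUnion_topSet μ]
  rw [lintegral_iUnion measurableSet_topSet pairwise_disjoint_topSet, tsum_fintype]

/-- Resampling coordinate `i` separates its value `t` from the rival values, which are then
conditioned to lie below `t`. -/
theorem setLIntegral_topSet_eq (i : Fin n) {f : (Fin n → ℝ) → ENNReal} (hf : Measurable f) :
    ∫⁻ w in topSet i, f w ∂Measure.pi μ =
      ∫⁻ t, ∫⁻ w in {w | ∀ j, j ≠ i → w j < t}, f (Function.update w i t) ∂Measure.pi μ ∂μ i := by
  rw [← lintegral_indicator (measurableSet_topSet i),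
    lintegral_pi_eq_resample μ i (hf.indicator (measurableSet_topSet i))]
  refine lintegral_congr fun t => ?_
  have hms : MeasurableSet {w : Fin n → ℝ | ∀ j, j ≠ i → w j < t} :=
    measurableSet_forall_ne i fun _ => measurableSet_Iio
  rw [← lintegral_indicator hms]
  refine lintegral_congr fun w => ?_
  have : Function.update w i t ∈ topSet i ↔ w ∈ {w : Fin n → ℝ | ∀ j, j ≠ i → w j < t} := by
    simp only [topSet, Set.mem_ofPred_eq, Function.update_self]
    exact forall_congr' fun j => forall_congr' fun hj => by rw [Function.update_of_ne hj]
  by_cases h : w ∈ {w : Fin n → ℝ | ∀ j, j ≠ i → w j < t}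
  · rw [Set.indicator_of_mem (this.2 h), Set.indicator_of_mem h]
  · rw [Set.indicator_of_notMem (this.not.2 h), Set.indicator_of_notMem h]

end MaxValue

/-! ### Averaging over the highest value. -/

namespace FirstPriceAuction

variable {n : ℕ} {A : FirstPriceAuction n} {μ : Fin n → Measure ℝ}
  [∀ i, IsProbabilityMeasure (μ i)] [∀ i, NullSingletonClass (μ i)] {β : Fin n → ℝ → ℝ}

/-- Ties in value are null, so the welfare splits over the agent on top, and the conditional
estimate applies to each piece. The product of the individual distribution functions is that of the
highest value. -/
theorem lintegral_leastFraction_le_welfare [Nonempty (Fin n)]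
    (hnonneg : ∀ i, ∀ᵐ v ∂(μ i), 0 ≤ v) (hβ : A.IsBayesNash μ β) :
    ∫⁻ z, ENNReal.ofReal z * ENNReal.ofReal
        (leastFraction (((Measure.pi μ).map fun w => ⨆ i, w i).real (Set.Iic z)))
        ∂(Measure.pi μ).map (fun w => ⨆ i, w i) ≤ A.welfare μ β := by
  have hm := hβ.1
  have hgood := hβ.ae_isBestBid A hnonneg
  have hν : IsProbabilityMeasure ((Measure.pi μ).map fun w => ⨆ i, w i) :=
    Measure.isProbabilityMeasure_map measurable_iSup_eval.aemeasurable
  have hmono := monotone_leastFraction_comp ((Measure.pi μ).map fun w => ⨆ i, w i)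
  simp only [measureReal_map_iSup_Iic] at hmono ⊢
  have hlm := hmono.measurable
  rw [lintegral_map (by fun_prop) measurable_iSup_eval, welfare, lintegral_pi_eq_sum_topSet μ,
    lintegral_pi_eq_sum_topSet μ]
  refine Finset.sum_le_sum fun i _ => ?_
  have hWm : Measurable fun w : Fin n → ℝ =>
      ∑ k, ENNReal.ofReal (w k * A.alloc (fun j => β j (w j)) k) :=
    Finset.measurable_fun_sum _ fun k _ => ((measurable_pi_apply k).mul
      ((A.measurable_alloc k).comp (measurable_bids hm))).ennreal_ofReal
  have hLm : Measurable fun w : Fin n → ℝ => ENNReal.ofReal (w i) *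
      ENNReal.ofReal (leastFraction (∏ k, (μ k).real (Set.Iic (w i)))) :=
    (measurable_pi_apply i).ennreal_ofReal.mul
      (hlm.comp (measurable_pi_apply i)).ennreal_ofReal
  have hleft : ∫⁻ w in topSet i, ENNReal.ofReal (⨆ j, w j) *
      ENNReal.ofReal (leastFraction (∏ k, (μ k).real (Set.Iic (⨆ j, w j)))) ∂Measure.pi μ =
      ∫⁻ w in topSet i, ENNReal.ofReal (w i) *
        ENNReal.ofReal (leastFraction (∏ k, (μ k).real (Set.Iic (w i)))) ∂Measure.pi μ :=
    setLIntegral_congr_fun (measurableSet_topSet i) fun w hw => by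
      simp only [iSup_eq_of_mem_topSet hw]
  rw [hleft, setLIntegral_topSet_eq μ i hLm, setLIntegral_topSet_eq μ i hWm]
  refine lintegral_mono_ae ?_
  filter_upwards [hgood i, ae_ae_update_of_ae μ i (ae_bid_le_of_alloc_pos hm hgood),
    ae_measureReal_Iic_pos (μ i), ae_measureReal_Iic_lt_one (μ i)] with v hv hover h0 h1
  refine le_trans (le_of_eq ?_) (hv.ofReal_mul_measure_le_setLIntegral hm hgood hover h0 h1)
  simp only [Function.update_self]
  rw [setLIntegral_const, ENNReal.ofReal_mul hv.value_nonneg]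

theorem ofReal_mul_optimalWelfare_le_welfare (hnonneg : ∀ i, ∀ᵐ v ∂(μ i), 0 ≤ v)
    (hβ : A.IsBayesNash μ β) :
    ENNReal.ofReal (∫ q in (0 : ℝ)..1, leastFraction q) * optimalWelfare μ ≤ A.welfare μ β := by
  have : Nonempty (Fin n) := by
    by_contra h
    rw [not_nonempty_iff] at h
    simpa using A.sum_alloc 0
  have hν : IsProbabilityMeasure ((Measure.pi μ).map fun w => ⨆ i, w i) :=
    Measure.isProbabilityMeasure_map measurable_iSup_eval.aemeasurable
  refine le_trans ?_ (lintegral_leastFraction_le_welfare hnonneg hβ)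
  -- The value and the guaranteed fraction both increase with the highest value, so they are
  -- positively correlated.
  refine le_trans ?_ (lintegral_mul_lintegral_le_of_monotone _
    (fun _ _ h => ENNReal.ofReal_le_ofReal h)
    fun _ _ h => ENNReal.ofReal_le_ofReal (monotone_leastFraction_comp _ h))
  rw [mul_comm, optimalWelfare_eq]
  gcongr
  exact ofReal_integral_leastFraction_le _

end FirstPriceAuction

theorem theorem1 {n : ℕ} (A : FirstPriceAuction n)
    (μ : Fin n → Measure ℝ) [∀ i, IsProbabilityMeasure (μ i)]
    (hdensity : ∀ i, μ i ≪ volume) (hnonneg : ∀ i, ∀ᵐ v ∂(μ i), 0 ≤ v)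
    (β : Fin n → ℝ → ℝ) (hβ : A.IsBayesNash μ β) :
    ENNReal.ofReal 0.743 * optimalWelfare μ ≤ A.welfare μ β ∧
    ∃ (l : ℝ → ℝ) (c : ℝ),
      (∀ q ∈ Set.Icc (0 : ℝ) 1, IsLeast (welfareFraction q '' Set.Icc (0 : ℝ) 1) (l q)) ∧
      IsLeast ((fun x => (∫ t in x..1, l t) / (1 - x)) '' Set.Ico (0 : ℝ) 1) c ∧
      0.743 ≤ c ∧ c < 0.744 ∧
      ENNReal.ofReal c * optimalWelfare μ ≤ A.welfare μ β := by
  have : ∀ i, NullSingletonClass (μ i) := fun i => ⟨fun x => hdensity i (measure_singleton x)⟩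
  have h := FirstPriceAuction.ofReal_mul_optimalWelfare_le_welfare hnonneg hβ
  refine ⟨le_trans ?_ h, leastFraction, _, fun q hq => isLeast_leastFraction hq,
    isLeast_integral_leastFraction, le_integral_leastFraction, integral_leastFraction_lt, h⟩
  gcongr
  exact le_integral_leastFraction
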